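/- **Notation.** Fix $0<q<1$, $\alpha_0,\alpha_1,\alpha_2\in\mathbb R$ and integers $N_1,N_2\ge 0$. Put $\sinh_q(x)=q^x-q^{-x}$, $\cosh_q(x)=q^x+q^{-x}$, $\lambda_x=\sinh_q(2x+\alpha_0)$, $\mu_x=\sinh_q(2x+\alpha_1)$, and $A_0=\sinh_q(\alpha_0)$, $A_1=\sinh_q(\alpha_1)$, $A_2=\cosh_q(\alpha_2)$, $A_{N_i}=\cosh_q(-N_i-1)$, $\sigma=\sinh_q(1)^2$. For elements of a complex algebra let $\mathcal{AW}(K,L\mid P_0,\dots,P_5)$ be the pair $$\cosh_q(2)KLK-K^2L-LK^2-\big[\sinh_q(1)^2(P_0P_1-P_2P_3)K-\cosh_q(1)^2P_5L+\cosh_q(1)(P_1P_3P_5+\sinh_q(1)^2P_0P_2)\big],$$ $$\cosh_q(2)LKL-L^2K-KL^2-\big[\sinh_q(1)^2(P_0P_1-P_2P_3)L-\cosh_q(1)^2P_4K+\cosh_q(1)(P_0P_3P_4+\sinh_q(1)^2P_1P_2)\big].$$ **The algebra.** $AW(A_{N_i})$ is the unital associative complex algebra with generators $K_1,L_1$ and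 relations $\mathcal{AW}(K_1,L_1\mid A_0,A_1,A_2,A_{N_i},\sigma,\sigma)=0$. $AW_2$ is the unital associative complex algebra generated by $AW(A_{N_1})\otimes AW(A_{N_2})$ and elements $K_2,L_2,M_2$ subject to $$\mathcal{AW}(K_2,L_2\mid A_0,A_1,A_2,M_2,\sigma,\sigma)=0,$$ $$\mathcal{AW}(1\otimes K_1,L_2\mid A_0,L_1\otimes1,A_2,A_{N_2},\sigma,\sigma)=0,\qquad \mathcal{AW}(K_2,L_1\otimes1\mid 1\otimes K_1,A_1,A_2,A_{N_1},\sigma,\sigma)=0,$$ $$\mathcal{AW}(1\otimes K_1,M_2\mid A_0,A_{N_1},-K_2,A_{N_2},-\sigma,\sigma)=0,\qquad \mathcal{AW}(M_2,L_1\otimes1\mid A_{N_2},A_1,-L_2,A_{N_1},\sigma,-\sigma)=0,$$ where in each relation the six structure parameters commute with each other and with the two generators of that relation. **The representation.** Let $V_1,V_2$ be complex vector spaces of dimensions $N_1+1,N_2+1$, and let $AW_2$ act on $V_1\otimes V_2$ so that $AW(A_{N_1})\otimes AW(A_{N_2})$ acts as the tensor product of representations on $V_1$ and $V_2$, where $L_1$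 acts on $V_1$ with a basis of eigenvectors $\phi_{m_1(j)}$, $0\le j\le N_1$, with eigenvalues $\mu_{m_1(j)}$, $m_1(j)=j-\frac{N_1}{2}$, and $K_1$ acts on $V_2$ with a basis of eigenvectors $\psi_{n_2(k)}$, $0\le k\le N_2$, with eigenvalues $\lambda_{n_2(k)}$, $n_2(k)=k-\frac{N_2}{2}$. Equip $V_1,V_2$ with the inner products for which these bases are orthonormal and $V_1\otimes V_2$ with the tensor product inner product. Assume the nondegeneracy condition $$\alpha_0-\alpha_1\pm\alpha_2\notin\{N_1+N_2-1-2i:\ 0\le i\le N_1+N_2-1\}.$$ **$q$-Racah polynomials.** $R_n(y_j;\alpha,\beta,\gamma,\delta;q)={}_4\phi_3\!\left(\begin{matrix}q^{-n},\alpha\beta q^{n+1},q^{-j},\gamma\delta q^{j+1}\\ \alpha q,\beta\delta q,\gamma q\end{matrix};q,q\right)$, $y_j=q^{-j}+\gamma\delta q^{j+1}$, the terminating series being summed over $0\le l\le n$. **Theorem.** Let $0\le k_1,j_1\le N_1$ and $0\le k_2,j_2\le N_2$. (i) For every $k_2$ there is a basis $\{\psi^{n_2}_{n_1(k_1)}\}_{k_1=0}^{N_1}$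 of $V_1$ such that, with $n_2=n_2(k_2)$ and $n_1(k_1)=k_1+n_2-\frac{N_1}2$, $$K_2(\psi^{n_2}_{n_1}\otimes\psi_{n_2})=\lambda_{n_1}\,\psi^{n_2}_{n_1}\otimes\psi_{n_2}.$$ For every $j_1$ there is a basis $\{\phi^{m_1}_{m_2(j_2)}\}_{j_2=0}^{N_2}$ of $V_2$ such that, with $m_1=m_1(j_1)$ and $m_2(j_2)=j_2+m_1-\frac{N_2}2$, $$L_2(\phi_{m_1}\otimes\phi^{m_1}_{m_2})=\mu_{m_2}\,\phi_{m_1}\otimes\phi^{m_1}_{m_2}.$$ (ii) For every choice of such nonzero vectors, the numerator and denominator of $$C(n_1,n_2,m_1,m_2)=\frac{\langle\phi_{m_1(0)},\psi_{n_1(0)}^{n_2}\rangle\,\langle\phi_{m_2(0)}^{m_1},\psi_{n_2(0)}\rangle}{\langle\phi_{m_1},\psi_{n_1(0)}^{n_2}\rangle\,\langle\phi_{m_2}^{m_1},\psi_{n_2(0)}\rangle\,\langle\phi_{m_1(0)},\psi_{n_1}^{n_2}\rangle\,\langle\phi_{m_2(0)}^{m_1},\psi_{n_2}\rangle}$$ are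 nonzero, and the normalized overlap coefficients $$P_{n_1,n_2}(m_1,m_2)=C(n_1,n_2,m_1,m_2)\,\langle\phi_{m_1}\otimes\phi_{m_2}^{m_1},\psi_{n_1}^{n_2}\otimes\psi_{n_2}\rangle$$ satisfy $P_{n_1(k_1),n_2(k_2)}(m_1(j_1),m_2(j_2))=R_{k_1,k_2}$, where $$R_{k_1,k_2}=R_{k_1}\big(y_{j_1};-q^{\alpha_0+2k_2-N_2+\alpha_1+\alpha_2-N_1-1},\,q^{\alpha_0+2k_2-N_2-\alpha_1-\alpha_2-N_1-1},\,q^{-2N_1-2},\,-q^{2\alpha_1};\,q^2\big)$$ $$\times R_{k_2}\big(y_{j_2};-q^{\alpha_0+\alpha_1+2j_1-N_1-\alpha_2-N_2-1},\,q^{\alpha_0-\alpha_1-2j_1+N_1+\alpha_2-N_2-1},\,q^{-2N_2-2},\,-q^{2\alpha_1+4j_1-2N_1};\,q^2\big),$$ with $y_{j_1}=q^{-2j_1}-q^{2\alpha_1-2N_1+2j_1}$ and $y_{j_2}=q^{-2j_2}-q^{2\alpha_1-2N_1-2N_2+4j_1+2j_2}$. (iii) Let $G_{n_1,n_2}(x_1,x_2;a_1,a_2,a_3,b,N;p)$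 be the hypergeometric part of the Gasper–Rahman bivariate $q$-Racah polynomial in base $p$, $${}_4\phi_3\!\left(\begin{matrix}p^{-n_1},ba_2p^{n_1},p^{-x_1},a_1p^{x_1}\\ bp,a_1a_2p^{x_2},p^{-x_2}\end{matrix};p,p\right){}_4\phi_3\!\left(\begin{matrix}p^{-n_2},ba_2a_3p^{2n_1+n_2},p^{n_1-x_2},a_1a_2p^{n_1+x_2}\\ ba_2p^{2n_1+1},a_1a_2a_3p^{n_1+N},p^{n_1-N}\end{matrix};p,p\right).$$ Put $\hat\alpha=\alpha_0-\alpha_1+\alpha_2$ and $$a_1=-q^{2\alpha_0+2\alpha_2+2},\quad a_2=q^{-2N_2},\quad a_3=q^{-2N_1},\quad b=-q^{2\alpha_0},\quad 2N=-\hat\alpha+N_1+N_2-1,$$ $$2x_1=2j_1+2j_2-\hat\alpha-N_1-N_2-1,\qquad 2x_2=2j_1-\hat\alpha-N_1+N_2-1.$$ Then $G_{k_2,k_1}(x_1,x_2;a_1,a_2,a_3,b,N;q^2)=c\,R_{k_1,k_2}$ with the nonzero prefactor (independent of $j_2$) $$c=s_{k_2}\big(-q^{2k_2+2\alpha_0-2N_2},\,-q^{2\alpha_0+2},\,q^{-2j_1+\hat\alpha+N_1-N_2+1}\big)\;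 s_{k_1}\big(-q^{4k_2+2k_1+2\alpha_0-2N_1-2N_2},\,-q^{4k_2+2\alpha_0-2N_2+2},\,q^{2k_2+\hat\alpha-N_1-N_2+1}\big),$$ where $s_n(a,d,f)=a^n\,\dfrac{(d/a;q^2)_n(f/a;q^2)_n}{(d;q^2)_n(f;q^2)_n}$ and $(a;q^2)_n=\prod_{i=0}^{n-1}(1-aq^{2i})$. -/

import Mathlib

open scoped TensorProduct

noncomputable section

namespace RankTwoAW

/-! ### The `q`-functions -/

/-- `sinh_q(x) = q^x - q^(-x)`. -/
def sinhq (q x : ℝ) : ℝ := q ^ x - q ^ (-x)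

/-- `cosh_q(x) = q^x + q^(-x)`. -/
def coshq (q x : ℝ) : ℝ := q ^ x + q ^ (-x)

/-- The `q`-shifted factorial `(a; q)_n = ∏_{i < n} (1 - a q^i)`. -/
def qPoch (a q : ℝ) (n : ℕ) : ℝ := ∏ i ∈ Finset.range n, (1 - a * q ^ i)

/-- The terminating basic hypergeometric series
`₄φ₃(q^(-n), a, b, c ; d, e, f ; q, q)`, a sum over `0 ≤ l ≤ n`. -/
def phi43 (n : ℕ) (a b c d e f q : ℝ) : ℝ :=
  ∑ l ∈ Finset.range (n + 1),
    (qPoch (q ^ (-(n : ℝ))) q l * qPoch a q l * qPoch b q l * qPoch c q l) /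
      (qPoch d q l * qPoch e q l * qPoch f q l * qPoch q q l) * q ^ l

/-- The `q`-Racah polynomial `R_n(y_j; α, β, γ, δ; q)`, evaluated at
`y_j = q^(-j) + γ δ q^(j+1)`. -/
def qRacah (n j : ℕ) (α β γ δ q : ℝ) : ℝ :=
  phi43 n (α * β * q ^ (n + 1)) (q ^ (-(j : ℝ))) (γ * δ * q ^ (j + 1))
    (α * q) (β * δ * q) (γ * q) q

/-- The bivariate `q`-Racah polynomial `R_{k₁,k₂}(y_{j₁}, y_{j₂}; α₀, α₁, α₂, N₁, N₂; q²)`: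
a product of two univariate ones in base `q²`. -/
def bivarQRacah (q α₀ α₁ α₂ : ℝ) (N₁ N₂ k₁ k₂ j₁ j₂ : ℕ) : ℝ :=
  qRacah k₁ j₁
      (-q ^ (α₀ + 2 * k₂ - N₂ + α₁ + α₂ - N₁ - 1))
      (q ^ (α₀ + 2 * k₂ - N₂ - α₁ - α₂ - N₁ - 1))
      (q ^ (-2 * (N₁ : ℝ) - 2))
      (-q ^ (2 * α₁))
      (q ^ 2) *
    qRacah k₂ j₂
      (-q ^ (α₀ + α₁ + 2 * j₁ - N₁ - α₂ - N₂ - 1))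
      (q ^ (α₀ - α₁ - 2 * j₁ + N₁ + α₂ - N₂ - 1))
      (q ^ (-2 * (N₂ : ℝ) - 2))
      (-q ^ (2 * α₁ + 4 * j₁ - 2 * N₁))
      (q ^ 2)

/-- The hypergeometric part of the Gasper–Rahman bivariate `q`-Racah polynomial
`R_{n₁,n₂}(x₁, x₂; a₁, a₂, a₃, b, N; p)` in base `p`. The variables `x₁, x₂` and the parameter `N`
are allowed to be real. -/
def gasperRahman (n₁ n₂ : ℕ) (x₁ x₂ a₁ a₂ a₃ b N p : ℝ) : ℝ :=
  phi43 n₁ (b * a₂ * p ^ n₁) (p ^ (-x₁)) (a₁ * p ^ x₁)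
      (b * p) (a₁ * a₂ * p ^ x₂) (p ^ (-x₂)) p *
    phi43 n₂ (b * a₂ * a₃ * p ^ (2 * n₁ + n₂)) (p ^ (n₁ - x₂)) (a₁ * a₂ * p ^ (n₁ + x₂))
      (b * a₂ * p ^ (2 * n₁ + 1)) (a₁ * a₂ * a₃ * p ^ (n₁ + N)) (p ^ (n₁ - N)) p

/-- The factor `a^n (d/a, f/a; p)_n / (d, f; p)_n`. -/
def searsFactor (n : ℕ) (a d f p : ℝ) : ℝ :=
  a ^ n * (qPoch (d / a) p n * qPoch (f / a) p n) / (qPoch d p n * qPoch f p n)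

/-! ### Askey–Wilson relations and the algebra `AW₂` -/

section Relations

variable {A : Type*} [Ring A] [Algebra ℂ A]

/-- First component of `𝒜𝒲(K, L | P₀, …, P₅)`. -/
def awFst (q : ℝ) (K L : A) (P : Fin 6 → A) : A :=
  (coshq q 2 : ℂ) • (K * L * K) - K ^ 2 * L - L * K ^ 2 -
    ((sinhq q 1 : ℂ) ^ 2 • ((P 0 * P 1 - P 2 * P 3) * K)
      - (coshq q 1 : ℂ) ^ 2 • (P 5 * L)
      + (coshq q 1 : ℂ) • (P 1 * P 3 * P 5 + (sinhq q 1 : ℂ) ^ 2 • (P 0 * P 2)))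

/-- Second component of `𝒜𝒲(K, L | P₀, …, P₅)`. -/
def awSnd (q : ℝ) (K L : A) (P : Fin 6 → A) : A :=
  (coshq q 2 : ℂ) • (L * K * L) - L ^ 2 * K - K * L ^ 2 -
    ((sinhq q 1 : ℂ) ^ 2 • ((P 0 * P 1 - P 2 * P 3) * L)
      - (coshq q 1 : ℂ) ^ 2 • (P 4 * K)
      + (coshq q 1 : ℂ) • (P 0 * P 3 * P 4 + (sinhq q 1 : ℂ) ^ 2 • (P 1 * P 2)))

end Relations

/-- The real constants on which `AW₂` depends. -/
structure Params where
  q : ℝ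
  A₀ : ℝ
  A₁ : ℝ
  A₂ : ℝ
  AN₁ : ℝ
  AN₂ : ℝ
  σL : ℝ
  σK : ℝ

/-- The generators `K₁ ⊗ 1`, `L₁ ⊗ 1`, `1 ⊗ K₁`, `1 ⊗ L₁`, `K₂`, `L₂`, `M₂` of `AW₂`. -/
inductive Gen
  | K1one | L1one | oneK1 | oneL1 | K2 | L2 | M2

/-- Two generators `K`, `L` of an Askey–Wilson relation and its structure parameters
`P₀, …, P₅`. -/
structure Row (A : Type*) where
  K : A
  L : A
  P : Fin 6 → A

/-- The seven Askey–Wilson relations that hold in `AW₂`. -/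
inductive RowIndex
  | left | right | diag | oneK1_L2 | K2_L1one | oneK1_M2 | M2_L1one

open FreeAlgebra in
/-- `left` and `right` are the relations of the two tensor factors `AW(A_{N₁})`, `AW(A_{N₂})`;
`diag` is the relation of `AW(M₂)`; the others are the mixed relations. -/
def row (p : Params) : RowIndex → Row (FreeAlgebra ℂ Gen)
  | .left => ⟨ι ℂ .K1one, ι ℂ .L1one, ![c p.A₀, c p.A₁, c p.A₂, c p.AN₁, c p.σL, c p.σK]⟩
  | .right => ⟨ι ℂ .oneK1, ι ℂ .oneL1, ![c p.A₀, c p.A₁, c p.A₂, c p.AN₂, c p.σL, c p.σK]⟩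
  | .diag => ⟨ι ℂ .K2, ι ℂ .L2, ![c p.A₀, c p.A₁, c p.A₂, ι ℂ .M2, c p.σL, c p.σK]⟩
  | .oneK1_L2 =>
      ⟨ι ℂ .oneK1, ι ℂ .L2, ![c p.A₀, ι ℂ .L1one, c p.A₂, c p.AN₂, c p.σL, c p.σK]⟩
  | .K2_L1one =>
      ⟨ι ℂ .K2, ι ℂ .L1one, ![ι ℂ .oneK1, c p.A₁, c p.A₂, c p.AN₁, c p.σL, c p.σK]⟩
  | .oneK1_M2 =>
      ⟨ι ℂ .oneK1, ι ℂ .M2,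
        ![c p.A₀, c p.AN₁, -ι ℂ .K2, c p.AN₂, c (-(sinhq p.q 1) ^ 2), c p.σK]⟩
  | .M2_L1one =>
      ⟨ι ℂ .M2, ι ℂ .L1one,
        ![c p.AN₂, c p.A₁, -ι ℂ .L2, c p.AN₁, c p.σL, c (-(sinhq p.q 1) ^ 2)]⟩
where
  /-- A real constant as an element of the free algebra. -/
  c (x : ℝ) : FreeAlgebra ℂ Gen := algebraMap ℂ (FreeAlgebra ℂ Gen) (x : ℂ)

open FreeAlgebra in
/-- The defining relations of `AW₂`: the Askey–Wilson relations, the local centrality of their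
structure parameters, and the commutation of the two factors of
`AW(A_{N₁}) ⊗ AW(A_{N₂})`. -/
inductive Rel (p : Params) : FreeAlgebra ℂ Gen → FreeAlgebra ℂ Gen → Prop
  | aw_fst (i : RowIndex) : Rel p (awFst p.q (row p i).K (row p i).L (row p i).P) 0
  | aw_snd (i : RowIndex) : Rel p (awSnd p.q (row p i).K (row p i).L (row p i).P) 0
  | central_param (i : RowIndex) (s t : Fin 6) :
      Rel p ((row p i).P s * (row p i).P t) ((row p i).P t * (row p i).P s)
  | central_K (i : RowIndex) (s : Fin 6) :
      Rel p ((row p i).P s * (row p i).K) ((row p i).K * (row p i).P s)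
  | central_L (i : RowIndex) (s : Fin 6) :
      Rel p ((row p i).P s * (row p i).L) ((row p i).L * (row p i).P s)
  | comm_KK : Rel p (ι ℂ .K1one * ι ℂ .oneK1) (ι ℂ .oneK1 * ι ℂ .K1one)
  | comm_KL : Rel p (ι ℂ .K1one * ι ℂ .oneL1) (ι ℂ .oneL1 * ι ℂ .K1one)
  | comm_LK : Rel p (ι ℂ .L1one * ι ℂ .oneK1) (ι ℂ .oneK1 * ι ℂ .L1one)
  | comm_LL : Rel p (ι ℂ .L1one * ι ℂ .oneL1) (ι ℂ .oneL1 * ι ℂ .L1one)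

/-- The rank 2 Askey–Wilson algebra `AW₂`. -/
abbrev AW2 (p : Params) : Type := RingQuot (Rel p)

/-- The generators as elements of `AW₂`. -/
def AW2.gen (p : Params) (g : Gen) : AW2 p :=
  RingQuot.mkAlgHom ℂ (Rel p) (FreeAlgebra.ι ℂ g)

/-- The constants `A₀ = sinh_q(α₀)`, `A₁ = sinh_q(α₁)`, `A₂ = cosh_q(α₂)`,
`A_{N_i} = cosh_q(-N_i - 1)`, `σ_L = σ_K = sinh_q(1)²`. -/
def stdParams (q α₀ α₁ α₂ : ℝ) (N₁ N₂ : ℕ) : Params where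
  q := q
  A₀ := sinhq q α₀
  A₁ := sinhq q α₁
  A₂ := coshq q α₂
  AN₁ := coshq q (-(N₁ : ℝ) - 1)
  AN₂ := coshq q (-(N₂ : ℝ) - 1)
  σL := (sinhq q 1) ^ 2
  σK := (sinhq q 1) ^ 2

/-! ### Representations, joint eigenvectors and overlap coefficients -/

/-- `λ_x = sinh_q(2x + α₀)`; with `α₁` in place of `α₀` this is `μ_x`. -/
def spec (q α x : ℝ) : ℝ := sinhq q (2 * x + α)

/-- `n₂(k) = k - N₂/2`; with `N₁` in place of `N₂` this is `m₁(j)`. -/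
def idx (N k : ℕ) : ℝ := k - N / 2

/-- `n₁(k₁) = k₁ + n₂(k₂) - N₁/2`; the same formula with indices exchanged gives
`m₂(j₂) = j₂ + m₁(j₁) - N₂/2`. -/
def idx' (N k N' k' : ℕ) : ℝ := k + idx N' k' - N / 2

section Rep

variable {V₁ V₂ : Type*} [NormedAddCommGroup V₁] [InnerProductSpace ℂ V₁]
  [NormedAddCommGroup V₂] [InnerProductSpace ℂ V₂]

/-- The representation `ρ` of `AW₂` on `V₁ ⊗ V₂` extends the tensor product of a representation
of `AW(A_{N₁})` on `V₁` (given by the operators `κ₁`, `ℓ₁`) and one of `AW(A_{N₂})` on `V₂`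
(given by `κ₂`, `ℓ₂`). -/
structure ExtendsTensor {p : Params} (ρ : AW2 p →ₐ[ℂ] Module.End ℂ (V₁ ⊗[ℂ] V₂))
    (κ₁ ℓ₁ : V₁ →ₗ[ℂ] V₁) (κ₂ ℓ₂ : V₂ →ₗ[ℂ] V₂) : Prop where
  K1one : ρ (AW2.gen p .K1one) = TensorProduct.map κ₁ LinearMap.id
  L1one : ρ (AW2.gen p .L1one) = TensorProduct.map ℓ₁ LinearMap.id
  oneK1 : ρ (AW2.gen p .oneK1) = TensorProduct.map LinearMap.id κ₂
  oneL1 : ρ (AW2.gen p .oneL1) = TensorProduct.map LinearMap.id ℓ₂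

/-- `ψ₁ k₂ k₁` stands for `ψ_{n₁(k₁)}^{n₂(k₂)} ∈ V₁`: it is nonzero and `ψ₁ k₂ k₁ ⊗ ψ₂ k₂` is an
eigenvector of `T` (the action of `K₂`) with eigenvalue `λ_{n₁(k₁)}`. -/
def IsKEigenfamily (q α₀ : ℝ) (N₁ N₂ : ℕ) (T : Module.End ℂ (V₁ ⊗[ℂ] V₂))
    (ψ₂ : Fin (N₂ + 1) → V₂) (ψ₁ : Fin (N₂ + 1) → Fin (N₁ + 1) → V₁) : Prop :=
  ∀ k₂ k₁, ψ₁ k₂ k₁ ≠ 0 ∧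
    T (ψ₁ k₂ k₁ ⊗ₜ[ℂ] ψ₂ k₂) = (spec q α₀ (idx' N₁ k₁ N₂ k₂) : ℂ) • (ψ₁ k₂ k₁ ⊗ₜ[ℂ] ψ₂ k₂)

/-- `φ₂ j₁ j₂` stands for `φ_{m₂(j₂)}^{m₁(j₁)} ∈ V₂`: it is nonzero and `φ₁ j₁ ⊗ φ₂ j₁ j₂` is an
eigenvector of `T` (the action of `L₂`) with eigenvalue `μ_{m₂(j₂)}`. -/
def IsLEigenfamily (q α₁ : ℝ) (N₁ N₂ : ℕ) (T : Module.End ℂ (V₁ ⊗[ℂ] V₂))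
    (φ₁ : Fin (N₁ + 1) → V₁) (φ₂ : Fin (N₁ + 1) → Fin (N₂ + 1) → V₂) : Prop :=
  ∀ j₁ j₂, φ₂ j₁ j₂ ≠ 0 ∧
    T (φ₁ j₁ ⊗ₜ[ℂ] φ₂ j₁ j₂) = (spec q α₁ (idx' N₂ j₂ N₁ j₁) : ℂ) • (φ₁ j₁ ⊗ₜ[ℂ] φ₂ j₁ j₂)

variable {N₁ N₂ : ℕ} (φ₁ : Fin (N₁ + 1) → V₁) (φ₂ : Fin (N₁ + 1) → Fin (N₂ + 1) → V₂)
  (ψ₁ : Fin (N₂ + 1) → Fin (N₁ + 1) → V₁) (ψ₂ : Fin (N₂ + 1) → V₂)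

/-- Numerator of the normalizing function `C`. -/
def normNum (k₂ : Fin (N₂ + 1)) (j₁ : Fin (N₁ + 1)) : ℂ :=
  inner ℂ (φ₁ 0) (ψ₁ k₂ 0) * inner ℂ (φ₂ j₁ 0) (ψ₂ 0)

/-- Denominator of the normalizing function `C`. -/
def normDen (k₁ : Fin (N₁ + 1)) (k₂ : Fin (N₂ + 1)) (j₁ : Fin (N₁ + 1)) (j₂ : Fin (N₂ + 1)) : ℂ :=
  inner ℂ (φ₁ j₁) (ψ₁ k₂ 0) * inner ℂ (φ₂ j₁ j₂) (ψ₂ 0) *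
    inner ℂ (φ₁ 0) (ψ₁ k₂ k₁) * inner ℂ (φ₂ j₁ 0) (ψ₂ k₂)

/-- The normalized overlap coefficient `P_{n₁(k₁),n₂(k₂)}(m₁(j₁), m₂(j₂))`. -/
def overlap (k₁ : Fin (N₁ + 1)) (k₂ : Fin (N₂ + 1)) (j₁ : Fin (N₁ + 1)) (j₂ : Fin (N₂ + 1)) : ℂ :=
  normNum φ₁ φ₂ ψ₁ ψ₂ k₂ j₁ / normDen φ₁ φ₂ ψ₁ ψ₂ k₁ k₂ j₁ j₂ *
    inner ℂ (φ₁ j₁ ⊗ₜ[ℂ] φ₂ j₁ j₂) (ψ₁ k₂ k₁ ⊗ₜ[ℂ] ψ₂ k₂)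

end Rep

/-! ### Comparison with the Gasper–Rahman polynomials -/

/-- The Gasper–Rahman polynomial in base `q²` with degrees `k₂, k₁` and the parameters and
variables
`a₁ = -q^(2α₀+2α₂+2)`, `a₂ = q^(-2N₂)`, `a₃ = q^(-2N₁)`, `b = -q^(2α₀)`,
`2N = -(α₀-α₁+α₂) + N₁ + N₂ - 1`, `2x₁ = 2j₁ + 2j₂ - (α₀-α₁+α₂) - N₁ - N₂ - 1`,
`2x₂ = 2j₁ - (α₀-α₁+α₂) - N₁ + N₂ - 1`. -/
def specializedGR (q α₀ α₁ α₂ : ℝ) (N₁ N₂ k₁ k₂ j₁ j₂ : ℕ) : ℝ :=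
  gasperRahman k₂ k₁
    ((2 * j₁ + 2 * j₂ - (α₀ - α₁ + α₂) - N₁ - N₂ - 1) / 2)
    ((2 * j₁ - (α₀ - α₁ + α₂) - N₁ + N₂ - 1) / 2)
    (-q ^ (2 * α₀ + 2 * α₂ + 2)) (q ^ (-2 * (N₂ : ℝ))) (q ^ (-2 * (N₁ : ℝ))) (-q ^ (2 * α₀))
    ((-(α₀ - α₁ + α₂) + N₁ + N₂ - 1) / 2) (q ^ 2)

/-- The explicit prefactor relating the two bivariate `q`-Racah polynomials. It does not depend on
`j₂`. -/
def grFactor (q α₀ α₁ α₂ : ℝ) (N₁ N₂ k₁ k₂ j₁ : ℕ) : ℝ :=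
  searsFactor k₂ (-q ^ (2 * k₂ + 2 * α₀ - 2 * N₂)) (-q ^ (2 * α₀ + 2))
      (q ^ (-2 * j₁ + (α₀ - α₁ + α₂) + N₁ - N₂ + 1)) (q ^ 2) *
    searsFactor k₁ (-q ^ (4 * k₂ + 2 * k₁ + 2 * α₀ - 2 * N₁ - 2 * N₂))
      (-q ^ (4 * k₂ + 2 * α₀ - 2 * N₂ + 2))
      (q ^ (2 * k₂ + (α₀ - α₁ + α₂) - N₁ - N₂ + 1)) (q ^ 2)

end RankTwoAW

end

/-!
The operator `1 ⊗ K₁` commutes with `K₂`, so `K₂` preserves each `V₁ ⊗ ψ_{n₂}`, and on this copy of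
`V₁` it forms an Askey–Wilson pair with `L₁`, with `A₀` replaced by the eigenvalue of `1 ⊗ K₁`, that
is, with `α₀` replaced by `α₀ + 2k₂ - N₂`. Likewise `L₂` preserves each `φ_{m₁} ⊗ V₂` and forms an
Askey–Wilson pair with `K₁` there. Both overlap coefficients are thereby reduced to one question:
given `K`, `L` on an `(N+1)`-dimensional space satisfying the Askey–Wilson relations (with `A₀`
replaced by `sinh_q(β₀)`), where `L` is diagonal with spectrum `sinh_q(2j - N + α₁)`, what are the
eigenvectors of `K`?

Entry `(i, j)` of the second relation is `K i j` times a coefficient that vanishes only for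
`|i - j| = 1`, up to an inhomogeneous term on the diagonal; hence `K` is tridiagonal with known
diagonal (`aw_tridiagonal`, `aw_diagonal`). The diagonal entries of the first relation then give the
products `K_{j,j+1} K_{j+1,j}` recursively (`aw_offdiagonal`). These are the coefficients of the
`q`-difference equation of the `q`-Racah polynomials (`racah_difference`, `awRacah_recurrence`), so
`K` has, for the eigenvalue `sinh_q(2k - N + β₀)`, an eigenvector with coordinates `g_j R_k(y_j)`,
where the weights `g_j` do not depend on `k`. The nondegeneracy condition makes the off-diagonal
products nonzero; therefore an eigenvector is determined by its first coordinate, which cannot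
vanish (`aw_matrix_eigenvector`, `aw_pair_eigenvector`).

Consequently each inner product is a constant depending on the eigenvector, times a weight, times a
`q`-Racah polynomial, and the normalization `C` cancels the constants and the weights because
`R_0 = 1` and `R_k(y_0) = 1`. For the second factor the polynomial appears with degree and variable
exchanged; the duality `phi43_comm_of_terminating` restores the order.

The comparison with the Gasper–Rahman polynomials is Sears' transformation of each of the two
terminating balanced `₄φ₃` (`sears_transformation`), itself a consequence of the `q`-Saalschütz sum
applied twice.
-/

namespace RankTwoAW

/-! ### `q`-shifted factorials -/

@[simp]
lemma qPoch_zero (a q : ℝ) : qPoch a q 0 = 1 := by simp [qPoch]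

lemma qPoch_succ (a q : ℝ) (n : ℕ) : qPoch a q (n + 1) = qPoch a q n * (1 - a * q ^ n) := by
  simp [qPoch, Finset.prod_range_succ]

lemma qPoch_succ' (a q : ℝ) (n : ℕ) : qPoch a q (n + 1) = (1 - a) * qPoch (a * q) q n := by
  simp only [qPoch, Finset.prod_range_succ']
  rw [mul_comm]
  congr 1
  · simp
  · exact Finset.prod_congr rfl fun i _ => by ring

lemma qPoch_add (a q : ℝ) (m n : ℕ) :
    qPoch a q (m + n) = qPoch a q m * qPoch (a * q ^ m) q n := by
  simp only [qPoch, Finset.prod_range_add]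
  congr 1
  exact Finset.prod_congr rfl fun i _ => by ring

lemma qPoch_ne_zero {a q : ℝ} {n : ℕ} (h : ∀ i < n, a * q ^ i ≠ 1) : qPoch a q n ≠ 0 :=
  Finset.prod_ne_zero_iff.2 fun i hi => sub_ne_zero.2 (h i (Finset.mem_range.1 hi)).symm

lemma qPoch_self_ne_zero {q : ℝ} (h₀ : 0 < q) (h₁ : q < 1) (n : ℕ) : qPoch q q n ≠ 0 :=
  qPoch_ne_zero fun i _ => by
    rw [← pow_succ']
    exact (pow_lt_one₀ h₀.le h₁ (Nat.succ_ne_zero i)).ne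

/-- `(q^(-n); q)_l` vanishes for `l > n`: this is what terminates the series. -/
lemma qPoch_inv_pow_eq_zero {q : ℝ} (hq : q ≠ 0) {n l : ℕ} (h : n < l) :
    qPoch (q ^ n)⁻¹ q l = 0 :=
  Finset.prod_eq_zero (Finset.mem_range.2 h) (by
    rw [inv_mul_cancel₀ (pow_ne_zero n hq), sub_self])

/-- Reversing the order of the factors of a `q`-shifted factorial. -/
lemma qPoch_reverse {q f : ℝ} (hq : q ≠ 0) (hf : f ≠ 0) (n : ℕ) :
    qPoch (q / (q ^ n * f)) q n * f ^ n =
      qPoch f q n * ∏ i ∈ Finset.range n, (-(q ^ i)⁻¹) := by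
  have h : qPoch (q / (q ^ n * f)) q n =
      ∏ i ∈ Finset.range n, (1 - (q ^ i)⁻¹ * f⁻¹) := by
    rw [qPoch, ← Finset.prod_range_reflect]
    refine Finset.prod_congr rfl fun i hi => ?_
    obtain ⟨m, rfl⟩ := Nat.exists_eq_add_of_lt (Finset.mem_range.1 hi)
    rw [show i + m + 1 - 1 - i = m by omega]
    field_simp
    ring
  rw [h, qPoch, ← Finset.prod_mul_distrib, Finset.pow_eq_prod_const, ← Finset.prod_mul_distrib]
  refine Finset.prod_congr rfl fun i _ => ?_
  field_simp
  ring

/-- `(q^(-(i+j)); q)_j` is `(q; q)_{i+j} / (q; q)_i` up to a sign and a power of `q`, both carried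
by the products. -/
lemma qPoch_inv_pow {q : ℝ} (hq : q ≠ 0) (i j : ℕ) :
    qPoch (q ^ (i + j))⁻¹ q j * q ^ j * qPoch q q i * ∏ r ∈ Finset.range i, (-(q ^ r)⁻¹) =
      qPoch q q (i + j) * ∏ r ∈ Finset.range (i + j), (-(q ^ r)⁻¹) := by
  induction j with
  | zero => simp
  | succ j ih =>
    rw [← add_assoc, qPoch_succ' _ _ j, qPoch_succ _ _ (i + j), Finset.prod_range_succ _ (i + j)]
    have h : (q ^ (i + j + 1))⁻¹ * q = (q ^ (i + j))⁻¹ := by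
      rw [pow_succ]
      field_simp
    rw [h, pow_succ q j]
    have h2 : (1 - (q ^ (i + j + 1))⁻¹) * q = (1 - q * q ^ (i + j)) * (-(q ^ (i + j))⁻¹) := by
      rw [pow_succ]
      field_simp
      ring
    linear_combination (1 - q * q ^ (i + j)) * (-(q ^ (i + j))⁻¹) * ih +
      qPoch (q ^ (i + j))⁻¹ q j * q ^ j * qPoch q q i *
        (∏ r ∈ Finset.range i, (-(q ^ r)⁻¹)) * h2

/-! ### The `q`-Saalschütz sum and Sears' transformation -/

/-- The `q`-Pfaff–Saalschütz sum, in a form without denominators that could vanish. -/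
theorem sum_antidiagonal_saalschuetz {p : ℝ} (h₀ : 0 < p) (h₁ : p < 1) (x y z : ℝ) (m : ℕ) :
    ∑ ij ∈ Finset.HasAntidiagonal.antidiagonal m,
      qPoch x p ij.1 * qPoch y p ij.1 * qPoch (x * y * z * p ^ ij.1) p ij.2 * qPoch z p ij.2 *
        z ^ ij.1 / (qPoch p p ij.1 * qPoch p p ij.2) =
      qPoch (x * z) p m * qPoch (y * z) p m / qPoch p p m := by
  have hP := qPoch_self_ne_zero h₀ h₁
  have h1 (n : ℕ) : 1 - p * p ^ n ≠ 0 := by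
    rw [← pow_succ']
    exact sub_ne_zero.2 (pow_lt_one₀ h₀.le h₁ (Nat.succ_ne_zero n)).ne'
  set τ : ℕ × ℕ → ℝ := fun ij =>
    qPoch x p ij.1 * qPoch y p ij.1 * qPoch (x * y * z * p ^ ij.1) p ij.2 * qPoch z p ij.2 *
        z ^ ij.1 / (qPoch p p ij.1 * qPoch p p ij.2) with hτ
  induction m with
  | zero => simp [hτ]
  | succ m ih =>
    -- `G` is the telescoping certificate for the recursion of the sum in `m`.
    set G : ℕ × ℕ → ℝ := fun ij =>
      x * y * z * p ^ m * (1 - p ^ ij.1) * (1 - p ^ ij.2) *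
        (qPoch x p ij.1 * qPoch y p ij.1 * qPoch (x * y * z * p ^ ij.1) p (ij.2 - 1) *
          qPoch z p ij.2 * z ^ ij.1 / (qPoch p p ij.1 * qPoch p p ij.2)) with hG
    have hGsum : ∑ ij ∈ Finset.HasAntidiagonal.antidiagonal m, G (ij.1 + 1, ij.2) =
        ∑ ij ∈ Finset.HasAntidiagonal.antidiagonal m, G (ij.1, ij.2 + 1) := by
      have e1 := Finset.Nat.sum_antidiagonal_succ (n := m) (f := G)
      have e2 := Finset.Nat.sum_antidiagonal_succ' (n := m) (f := G)
      have z1 : G (0, m + 1) = 0 := by simp [hG]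
      have z2 : G (m + 1, 0) = 0 := by simp [hG]
      linarith
    have hsplit : (1 - p ^ (m + 1)) * ∑ ij ∈ Finset.HasAntidiagonal.antidiagonal (m + 1), τ ij =
        ∑ ij ∈ Finset.HasAntidiagonal.antidiagonal m,
          ((1 - p ^ (ij.2 + 1)) * τ (ij.1, ij.2 + 1) +
            p ^ ij.2 * (1 - p ^ (ij.1 + 1)) * τ (ij.1 + 1, ij.2)) := by
      have e1 := Finset.Nat.sum_antidiagonal_succ (n := m)
        (f := fun ij => p ^ ij.2 * (1 - p ^ ij.1) * τ ij)
      have e2 := Finset.Nat.sum_antidiagonal_succ' (n := m)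
        (f := fun ij => (1 - p ^ ij.2) * τ ij)
      simp only [pow_zero, sub_self, mul_zero, zero_mul, zero_add] at e1 e2
      rw [Finset.sum_add_distrib, ← e1, ← e2, Finset.mul_sum, ← Finset.sum_add_distrib]
      refine Finset.sum_congr rfl fun ij hij => ?_
      rw [← Finset.HasAntidiagonal.mem_antidiagonal.1 hij, pow_add]
      ring
    have hterm : ∀ ij ∈ Finset.HasAntidiagonal.antidiagonal m,
        (1 - p ^ (ij.2 + 1)) * τ (ij.1, ij.2 + 1) +
            p ^ ij.2 * (1 - p ^ (ij.1 + 1)) * τ (ij.1 + 1, ij.2) =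
          (1 - x * z * p ^ m) * (1 - y * z * p ^ m) * τ ij +
            (G (ij.1 + 1, ij.2) - G (ij.1, ij.2 + 1)) := by
      rintro ⟨j, i⟩ hij
      have hm : m = j + i := (Finset.HasAntidiagonal.mem_antidiagonal.1 hij).symm
      have hj := hP j
      have hi := hP i
      have hj1 := h1 j
      have hi1 := h1 i
      cases i with
      | zero =>
        simp only [hτ, hG, hm, qPoch_succ _ _ j, qPoch_succ _ _ 0, qPoch_zero, pow_zero, mul_one,
          add_zero, zero_add, sub_self, mul_zero, zero_mul, pow_succ, zero_sub, one_mul,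
          Nat.sub_self]
        have h10 : 1 - p ≠ 0 := sub_ne_zero.2 h₁.ne'
        field_simp
        ring
      | succ i =>
        have hi0 := h1 i
        have hii := hP i
        have e1 : qPoch (x * y * z * p ^ j) p (i + 1) =
          (1 - x * y * z * p ^ j) * qPoch (x * y * z * p ^ (j + 1)) p i := by
          rw [qPoch_succ', pow_succ, mul_assoc _ (p ^ j) p]
        have e2 : qPoch (x * y * z * p ^ j) p (i + 1 + 1) =
          (1 - x * y * z * p ^ j) * qPoch (x * y * z * p ^ (j + 1)) p i *
            (1 - x * y * z * p ^ j * p ^ (i + 1)) := by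
          rw [qPoch_succ, e1]
        have e3 := qPoch_succ (x * y * z * p ^ (j + 1)) p i
        have e4 := qPoch_succ z p (i + 1)
        simp only [hτ, hG, hm, Nat.add_sub_cancel]
        rw [e2, e1, e3, e4, qPoch_succ x p j, qPoch_succ y p j, qPoch_succ p p j,
          qPoch_succ p p (i + 1)]
        simp only [pow_succ, pow_add] at hi1 ⊢
        generalize p ^ i = I at *
        generalize p ^ j = J at *
        have hi2 : 1 - I * p ^ 2 ≠ 0 := by convert hi1 using 2; ring
        field_simp
        ring
    have key : (1 - p * p ^ m) * ∑ ij ∈ Finset.HasAntidiagonal.antidiagonal (m + 1), τ ij =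
        (1 - x * z * p ^ m) * (1 - y * z * p ^ m) *
          (qPoch (x * z) p m * qPoch (y * z) p m / qPoch p p m) := by
      rw [← pow_succ', hsplit, Finset.sum_congr rfl hterm, Finset.sum_add_distrib,
        Finset.sum_sub_distrib, hGsum, sub_self, add_zero, ← Finset.mul_sum, ih]
    have hm := h1 m
    have hPm := hP m
    rw [qPoch_succ, qPoch_succ, qPoch_succ, eq_div_iff (mul_ne_zero hPm hm)]
    rw [mul_div_assoc', eq_div_iff hPm] at key
    linear_combination key

lemma prod_neg_inv_pow_ne_zero {p : ℝ} (hp : p ≠ 0) (n : ℕ) :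
    ∏ i ∈ Finset.range n, (-(p ^ i)⁻¹) ≠ 0 :=
  Finset.prod_ne_zero_iff.2 fun i _ => neg_ne_zero.2 (inv_ne_zero (pow_ne_zero i hp))

lemma sq_prod_neg_inv_pow {p : ℝ} (hp : p ≠ 0) (r i : ℕ) :
    (∏ s ∈ Finset.range (r + i), (-(p ^ s)⁻¹)) ^ 2 * p ^ (i * (i + 2 * r)) =
      (∏ s ∈ Finset.range r, (-(p ^ s)⁻¹)) ^ 2 * p ^ i := by
  induction i with
  | zero => simp
  | succ i ih =>
    rw [← add_assoc, Finset.prod_range_succ, mul_pow,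
      show (i + 1) * (i + 1 + 2 * r) = i * (i + 2 * r) + (r + i) + (r + i) + 1 by ring, pow_succ,
      pow_add, pow_add]
    have h : (-(p ^ (r + i))⁻¹) ^ 2 * (p ^ (r + i) * p ^ (r + i)) = 1 := by
      field_simp
    rw [pow_succ p i]
    linear_combination (∏ s ∈ Finset.range (r + i), (-(p ^ s)⁻¹)) ^ 2 * p ^ (i * (i + 2 * r)) * p *
      h + p * ih

lemma qPoch_left_ne_zero {a p : ℝ} {m n : ℕ} (h : qPoch a p (m + n) ≠ 0) : qPoch a p m ≠ 0 := by
  rw [qPoch_add] at h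
  exact left_ne_zero_of_mul h

lemma qPoch_right_ne_zero {a p : ℝ} {m n : ℕ} (h : qPoch a p (m + n) ≠ 0) :
    qPoch (a * p ^ m) p n ≠ 0 := by
  rw [qPoch_add] at h
  exact right_ne_zero_of_mul h

/-- The `q`-Pfaff–Saalschütz sum: a terminating balanced `₃φ₂` is a product. -/
theorem sum_saalschuetz {p : ℝ} (h₀ : 0 < p) (h₁ : p < 1) {A Z D F : ℝ} {M : ℕ}
    (hA : A ≠ 0) (hF : F ≠ 0) (hbal : D * F * p ^ M = A * Z * p)
    (hDM : qPoch D p M ≠ 0) (hFM : qPoch F p M ≠ 0) :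
    ∑ i ∈ Finset.range (M + 1), qPoch (p ^ M)⁻¹ p i * qPoch A p i * qPoch Z p i * p ^ i /
        (qPoch D p i * qPoch F p i * qPoch p p i) =
      A ^ M * (qPoch (D / A) p M * qPoch (F / A) p M) / (qPoch D p M * qPoch F p M) := by
  have hp := h₀.ne'
  have hP := qPoch_self_ne_zero h₀ h₁
  set c : ℕ → ℝ := fun n => ∏ s ∈ Finset.range n, (-(p ^ s)⁻¹) with hc
  have hc0 : ∀ n, c n ≠ 0 := prod_neg_inv_pow_ne_zero hp
  set z : ℝ := p / (p ^ M * F) with hz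
  have hxyz : A * Z * z = D := by
    rw [hz]
    field_simp
    linear_combination -hbal
  have hxz : A * z = p / (p ^ M * (F / A)) := by
    rw [hz]
    field_simp
  have hyz : Z * z = D / A := by
    rw [eq_div_iff hA, ← hxyz]
    ring
  have hS := sum_antidiagonal_saalschuetz h₀ h₁ A Z z M
  rw [hxz, hyz, hxyz, Finset.Nat.sum_antidiagonal_eq_sum_range_succ_mk] at hS
  have hrev := qPoch_reverse hp (div_ne_zero hF hA) M
  have hterm : ∀ i ∈ Finset.range (M + 1),
      qPoch (p ^ M)⁻¹ p i * qPoch A p i * qPoch Z p i * p ^ i /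
        (qPoch D p i * qPoch F p i * qPoch p p i) =
      F ^ M * qPoch p p M / (c M * (qPoch D p M * qPoch F p M)) *
        (qPoch A p i * qPoch Z p i * qPoch (D * p ^ i) p (M - i) * qPoch z p (M - i) *
          z ^ i / (qPoch p p i * qPoch p p (M - i))) := by
    intro i hi
    obtain ⟨r, hr⟩ := Nat.exists_eq_add_of_le (Nat.lt_succ_iff.1 (Finset.mem_range.1 hi))
    rw [show M - i = r by omega]
    have e1 := qPoch_inv_pow hp r i
    have e2 := sq_prod_neg_inv_pow hp r i
    have e3 := qPoch_reverse hp (mul_ne_zero hF (pow_ne_zero i hp)) r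
    have hz' : p / (p ^ r * (F * p ^ i)) = z := by
      rw [hz, hr, pow_add]
      congr 1
      ring
    have hz2 : z ^ i * F ^ i * p ^ (i * (i + r)) = p ^ i := by
      rw [hz, hr, ← mul_pow, pow_mul' p i (i + r), ← mul_pow]
      congr 1
      field_simp
    rw [hz'] at e3
    rw [add_comm r i, ← hr] at e1 e2
    have hpi : (p ^ i) ^ r = p ^ (i * r) := (pow_mul p i r).symm
    rw [mul_pow, hpi] at e3
    change _ * c r = _ * c M at e1
    change c M ^ 2 * _ = c r ^ 2 * _ at e2
    change _ = _ * c r at e3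
    have f1 : qPoch D p M = qPoch D p i * qPoch (D * p ^ i) p r := by rw [hr, qPoch_add]
    have f2 : qPoch F p M = qPoch F p i * qPoch (F * p ^ i) p r := by rw [hr, qPoch_add]
    rw [f1] at hDM
    rw [f2] at hFM
    have g1 := left_ne_zero_of_mul hDM
    have g2 := right_ne_zero_of_mul hDM
    have g3 := left_ne_zero_of_mul hFM
    have g4 := right_ne_zero_of_mul hFM
    have hM := hP M
    have hi' := hP i
    have hr' := hP r
    have hcM := hc0 M
    have hcr := hc0 r
    have hpir : p ^ (i * (i + 2 * r)) = p ^ (i * (i + r)) * p ^ (i * r) := by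
      rw [← pow_add]
      congr 1
      ring
    rw [hpir] at e2
    rw [f1, f2]
    have hFM' : F ^ M = F ^ i * F ^ r := by rw [hr, pow_add]
    rw [hFM']
    have n1 := pow_ne_zero (i * (i + r)) hp
    have n2 := pow_ne_zero (i * r) hp
    -- The powers of `p` produced by the two reversals cancel.
    have key : qPoch (p ^ M)⁻¹ p i * p ^ i * c M * qPoch p p r * qPoch (F * p ^ i) p r =
        F ^ i * F ^ r * qPoch p p M * qPoch z p r * z ^ i := by
      have k1 : (qPoch (p ^ M)⁻¹ p i * p ^ i * c M * qPoch p p r * qPoch (F * p ^ i) p r) *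
          (c r * (p ^ (i * (i + r)) * p ^ (i * r))) =
          (F ^ i * F ^ r * qPoch p p M * qPoch z p r * z ^ i) *
          (c r * (p ^ (i * (i + r)) * p ^ (i * r))) := by
        linear_combination (qPoch (F * p ^ i) p r * c M * p ^ (i * (i + r)) * p ^ (i * r)) * e1 +
          qPoch p p M * qPoch (F * p ^ i) p r * e2 - qPoch p p M * c r * p ^ i * e3 -
          (F ^ r * qPoch p p M * qPoch z p r * c r * p ^ (i * r)) * hz2
      exact mul_right_cancel₀ (mul_ne_zero hcr (mul_ne_zero n1 n2)) k1
    rw [div_mul_div_comm, div_eq_div_iff (by positivity) (by positivity)]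
    linear_combination (qPoch A p i * qPoch Z p i * qPoch D p i * qPoch F p i * qPoch p p i *
      qPoch (D * p ^ i) p r) * key
  rw [Finset.sum_congr rfl hterm, ← Finset.mul_sum]
  rw [Nat.succ_eq_add_one] at hS
  rw [hS]
  have hM := hP M
  have hcM := hc0 M
  change _ = _ * c M at hrev
  have hAM := pow_ne_zero M hA
  rw [div_pow] at hrev
  have hrev' : qPoch (p / (p ^ M * (F / A))) p M * F ^ M = A ^ M * qPoch (F / A) p M * c M := by
    rw [mul_div_assoc', div_eq_iff hAM] at hrev
    linear_combination hrev
  rw [div_mul_div_comm, div_eq_div_iff (by positivity) (by positivity)]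
  linear_combination (qPoch D p M * qPoch F p M * qPoch p p M * qPoch (D / A) p M) * hrev'

lemma rpow_neg_natCast {q : ℝ} (hq : 0 < q) (n : ℕ) : q ^ (-(n : ℝ)) = (q ^ n)⁻¹ := by
  rw [Real.rpow_neg hq.le, Real.rpow_natCast]

/-- Sears' transformation of a terminating balanced `₄φ₃`. One factor of each summand is expanded by
the `q`-Saalschütz sum, and after interchanging the two summations the inner sum is again a
`q`-Saalschütz sum. -/
theorem sears_transformation {p : ℝ} (h₀ : 0 < p) (h₁ : p < 1) {n : ℕ} {a b c d e f : ℝ}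
    (ha : a ≠ 0) (hb : b ≠ 0) (hc : c ≠ 0) (hd : d ≠ 0) (he : e ≠ 0) (hf : f ≠ 0)
    (hbal : d * e * f * p ^ n = a * b * c * p)
    (hdn : qPoch d p n ≠ 0) (hen : qPoch e p n ≠ 0) (hfn : qPoch f p n ≠ 0)
    (hda : qPoch (d / a) p n ≠ 0) (hfa : qPoch (f / a) p n ≠ 0) :
    phi43 n a b c d e f p = searsFactor n a d f p *
      phi43 n a (e / b) (e / c) e (a * p / (p ^ n * f)) (a * p / (p ^ n * d)) p := by
  have hp := h₀.ne'
  have hP := qPoch_self_ne_zero h₀ h₁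
  set x := e / b with hx
  set y := e / c with hy
  set z := b * c / e with hz
  have hxz : x * z = c := by rw [hx, hz]; field_simp
  have hyz : y * z = b := by rw [hy, hz]; field_simp
  have hxyz : x * y * z = e := by rw [hx, hy, hz]; field_simp
  have hzbal : d * f * p ^ n = a * z * p := by
    rw [hz]
    field_simp
    linear_combination hbal
  -- Summand of the double sum, with `m = j + i` the original summation index.
  set g : ℕ → ℕ → ℝ := fun j i =>
    (qPoch (p ^ n)⁻¹ p j * qPoch a p j * p ^ j * qPoch x p j * qPoch y p j * z ^ j /
      (qPoch d p j * qPoch f p j * qPoch e p j * qPoch p p j)) *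
    (qPoch (p ^ (n - j))⁻¹ p i * qPoch (a * p ^ j) p i * qPoch z p i * p ^ i /
      (qPoch (d * p ^ j) p i * qPoch (f * p ^ j) p i * qPoch p p i)) with hg
  have hL : phi43 n a b c d e f p =
      ∑ m ∈ Finset.range (n + 1), ∑ j ∈ Finset.range (m + 1), g j (m - j) := by
    unfold phi43
    refine Finset.sum_congr rfl fun m hm => ?_
    have hmn := Nat.lt_succ_iff.1 (Finset.mem_range.1 hm)
    have hS := sum_antidiagonal_saalschuetz h₀ h₁ x y z m
    rw [hxz, hyz, hxyz, Finset.Nat.sum_antidiagonal_eq_sum_range_succ_mk] at hS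
    rw [rpow_neg_natCast h₀]
    calc _ = qPoch (p ^ n)⁻¹ p m * qPoch a p m * p ^ m /
            (qPoch d p m * qPoch f p m * qPoch e p m) *
            (qPoch c p m * qPoch b p m / qPoch p p m) := by
          rw [div_mul_div_comm, div_mul_eq_mul_div]
          congr 1 <;> ring
      _ = _ := by
          rw [← hS, Finset.mul_sum]
          refine Finset.sum_congr rfl fun j hj => ?_
          obtain ⟨i, rfl⟩ := Nat.exists_eq_add_of_le (Nat.lt_succ_iff.1 (Finset.mem_range.1 hj))
          obtain ⟨r, rfl⟩ := Nat.exists_eq_add_of_le hmn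
          rw [hg]
          simp only [Nat.add_sub_cancel_left]
          rw [show j + i + r - j = i + r by omega]
          have e0 : (p ^ (j + i + r))⁻¹ * p ^ j = (p ^ (i + r))⁻¹ := by
            rw [add_assoc, pow_add p j]
            field_simp
          have d1 := qPoch_left_ne_zero hdn
          have d2 := qPoch_left_ne_zero hen
          have d3 := qPoch_left_ne_zero hfn
          rw [qPoch_add] at d1 d2 d3
          rw [qPoch_add _ p j i, qPoch_add _ p j i, qPoch_add _ p j i, qPoch_add _ p j i,
            qPoch_add _ p j i, e0, pow_add p j i]
          have hj' := hP j
          have hi' := hP i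
          have d11 := left_ne_zero_of_mul d1
          have d12 := right_ne_zero_of_mul d1
          have d21 := left_ne_zero_of_mul d2
          have d22 := right_ne_zero_of_mul d2
          have d31 := left_ne_zero_of_mul d3
          have d32 := right_ne_zero_of_mul d3
          rw [div_mul_div_comm, div_mul_div_comm, div_eq_div_iff (by positivity) (by positivity)]
          ring
  rw [hL, Finset.sum_range_diag_flip]
  unfold phi43
  rw [Finset.mul_sum]
  refine Finset.sum_congr rfl fun j hj => ?_
  obtain ⟨r, rfl⟩ := Nat.exists_eq_add_of_le (Nat.lt_succ_iff.1 (Finset.mem_range.1 hj))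
  rw [hg]
  simp only [Nat.add_sub_cancel_left]
  rw [← Finset.mul_sum, show j + r + 1 - j = r + 1 by omega]
  have hpj := pow_ne_zero j hp
  have hbal' : d * p ^ j * (f * p ^ j) * p ^ r = a * p ^ j * z * p := by
    rw [pow_add] at hzbal
    linear_combination p ^ j * hzbal
  rw [sum_saalschuetz h₀ h₁ (mul_ne_zero ha hpj) (mul_ne_zero hf hpj) hbal'
    (qPoch_right_ne_zero hdn) (qPoch_right_ne_zero hfn), mul_div_mul_right _ _ hpj,
    mul_div_mul_right _ _ hpj, rpow_neg_natCast h₀]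
  unfold searsFactor
  have hcj := prod_neg_inv_pow_ne_zero hp j
  have hcj2 := sq_prod_neg_inv_pow hp 0 j
  simp only [Finset.prod_range_zero, zero_add, mul_zero, add_zero] at hcj2
  -- Reversal turns the shifted factorials of the new denominator parameters into those of `d / a`
  -- and `f / a`.
  have rev (u : ℝ) (hu : u ≠ 0) (hun : qPoch (u / a) p (j + r) ≠ 0) :
      qPoch (a * p / (p ^ (j + r) * u)) p j ≠ 0 ∧
      qPoch (u / a) p r * qPoch (a * p / (p ^ (j + r) * u)) p j * (u ^ j * p ^ (j * r)) =
        a ^ j * qPoch (u / a) p (j + r) * ∏ s ∈ Finset.range j, (-(p ^ s)⁻¹) := by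
    have hua := div_ne_zero hu ha
    have h1 := qPoch_reverse hp (mul_ne_zero hua (pow_ne_zero r hp)) j
    have h2 : p / (p ^ j * (u / a * p ^ r)) = a * p / (p ^ (j + r) * u) := by
      rw [pow_add]
      field_simp
    rw [h2, mul_pow, div_pow, ← pow_mul, mul_comm r j] at h1
    have h3 : qPoch (u / a) p (j + r) = qPoch (u / a) p r * qPoch (u / a * p ^ r) p j := by
      rw [add_comm, qPoch_add]
    rw [h3] at hun ⊢
    refine ⟨fun h0 => ?_, ?_⟩
    · rw [h0, zero_mul] at h1
      exact mul_ne_zero (right_ne_zero_of_mul hun) hcj h1.symm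
    · have haj := pow_ne_zero j ha
      rw [mul_comm (_ / _), mul_div_assoc', mul_div_assoc', div_eq_iff haj] at h1
      linear_combination qPoch (u / a) p r * h1
  obtain ⟨rd0, rd⟩ := rev d hd hda
  obtain ⟨rf0, rf⟩ := rev f hf hfa
  have hzj : z ^ j * a ^ j * p ^ j = d ^ j * f ^ j * p ^ (j * j) * p ^ (j * r) := by
    rw [mul_assoc (d ^ j * f ^ j), ← pow_add, ← mul_add, pow_mul' p j (j + r), ← mul_pow, ← mul_pow,
      ← mul_pow, ← mul_pow, hzbal, mul_comm a z]
  have f1 : qPoch d p (j + r) = qPoch d p j * qPoch (d * p ^ j) p r := qPoch_add ..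
  have f2 : qPoch f p (j + r) = qPoch f p j * qPoch (f * p ^ j) p r := qPoch_add ..
  rw [f1] at hdn ⊢
  rw [f2] at hfn ⊢
  have d1 := left_ne_zero_of_mul hdn
  have d2 := right_ne_zero_of_mul hdn
  have d3 := left_ne_zero_of_mul hfn
  have d4 := right_ne_zero_of_mul hfn
  have d5 := qPoch_left_ne_zero hen
  have hj' := hP j
  have key : z ^ j * (a ^ r * p ^ (j * r)) * (qPoch (d / a) p r * qPoch (f / a) p r) *
      (qPoch (a * p / (p ^ (j + r) * f)) p j * qPoch (a * p / (p ^ (j + r) * d)) p j) =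
      a ^ (j + r) * (qPoch (d / a) p (j + r) * qPoch (f / a) p (j + r)) := by
    have hne : a ^ j * p ^ j * (d ^ j * p ^ (j * r)) * (f ^ j * p ^ (j * r)) ≠ 0 := by positivity
    refine mul_right_cancel₀ hne ?_
    set C := ∏ s ∈ Finset.range j, (-(p ^ s)⁻¹)
    set X := qPoch (d / a) p r
    set Y := qPoch (f / a) p r
    set X' := qPoch (a * p / (p ^ (j + r) * f)) p j
    set Y' := qPoch (a * p / (p ^ (j + r) * d)) p j
    set X1 := qPoch (d / a) p (j + r)
    set Y1 := qPoch (f / a) p (j + r)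
    rw [pow_add a]
    linear_combination a ^ r * p ^ (j * r) * X * Y * X' * Y' *
        (d ^ j * p ^ (j * r) * (f ^ j * p ^ (j * r))) * hzj +
      a ^ r * p ^ (j * r) * p ^ (j * r) * p ^ (j * j) * d ^ j * f ^ j *
        (Y * X' * f ^ j * p ^ (j * r) * rd + a ^ j * X1 * C * rf) +
      a ^ r * p ^ (j * r) * p ^ (j * r) * d ^ j * f ^ j * a ^ j * a ^ j * X1 * Y1 * hcj2
  rw [mul_pow, ← pow_mul]
  rw [div_mul_div_comm, div_mul_eq_mul_div _ _ (p ^ j), div_mul_div_comm,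
    div_eq_div_iff (by positivity) (by positivity)]
  linear_combination (qPoch (p ^ (j + r))⁻¹ p j * qPoch a p j * p ^ j * qPoch x p j *
    qPoch y p j * (qPoch d p j * qPoch f p j * qPoch e p j * qPoch p p j *
      (qPoch (d * p ^ j) p r * qPoch (f * p ^ j) p r))) * key

/-! ### The `q`-difference equation and the duality of the `q`-Racah polynomials -/

/-- The `q`-Racah polynomial as a function of `X = q^j`, which may be any real number. -/
noncomputable def qRacahFun (n : ℕ) (α β γ δ q X : ℝ) : ℝ :=
  phi43 n (α * β * q ^ (n + 1)) X⁻¹ (γ * δ * q * X) (α * q) (β * δ * q) (γ * q) q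

lemma qRacah_eq_qRacahFun {q : ℝ} (hq : 0 < q) (n j : ℕ) (α β γ δ : ℝ) :
    qRacah n j α β γ δ q = qRacahFun n α β γ δ q (q ^ j) := by
  rw [qRacah, qRacahFun, rpow_neg_natCast hq]
  congr 1
  ring

lemma qRacahFun_one (n : ℕ) (α β γ δ q : ℝ) : qRacahFun n α β γ δ q 1 = 1 := by
  rw [qRacahFun, phi43, Finset.sum_range_succ']
  simp [qPoch_succ']

/-- Coefficient of the forward shift in the `q`-difference equation, at `X = p^x`. -/
noncomputable def racahB (α β γ δ p X : ℝ) : ℝ :=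
  (1 - α * p * X) * (1 - β * δ * p * X) * (1 - γ * p * X) * (1 - γ * δ * p * X) /
    ((1 - γ * δ * p * X ^ 2) * (1 - γ * δ * p ^ 2 * X ^ 2))

/-- Coefficient of the backward shift in the `q`-difference equation, at `X = p^x`. -/
noncomputable def racahD (α β γ δ p X : ℝ) : ℝ :=
  p * (1 - X) * (1 - δ * X) * (β - γ * X) * (α - γ * δ * X) /
    ((1 - γ * δ * X ^ 2) * (1 - γ * δ * p * X ^ 2))

/-- The `q`-difference operator acts on the basis `(X⁻¹, γδpX; p)_l` as a two-term operator. -/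
lemma racah_difference_basis {α β γ δ p X : ℝ} (hp : p ≠ 0) (hX : X ≠ 0)
    (h0 : 1 - γ * δ * X ^ 2 ≠ 0) (h1 : 1 - γ * δ * p * X ^ 2 ≠ 0)
    (h2 : 1 - γ * δ * p ^ 2 * X ^ 2 ≠ 0) (l : ℕ) :
    racahB α β γ δ p X *
        (qPoch (p * X)⁻¹ p (l + 1) * qPoch (γ * δ * p * (p * X)) p (l + 1) -
          qPoch X⁻¹ p (l + 1) * qPoch (γ * δ * p * X) p (l + 1)) -
      racahD α β γ δ p X *
        (qPoch X⁻¹ p (l + 1) * qPoch (γ * δ * p * X) p (l + 1) -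
          qPoch (X / p)⁻¹ p (l + 1) * qPoch (γ * δ * p * (X / p)) p (l + 1)) =
      (p ^ (l + 1))⁻¹ * (1 - p ^ (l + 1)) *
        ((1 - α * β * p ^ (l + 2)) * (qPoch X⁻¹ p (l + 1) * qPoch (γ * δ * p * X) p (l + 1)) -
          (1 - α * p ^ (l + 1)) * (1 - β * δ * p ^ (l + 1)) * (1 - γ * p ^ (l + 1)) *
            (qPoch X⁻¹ p l * qPoch (γ * δ * p * X) p l)) := by
  have e1 : (p * X)⁻¹ * p = X⁻¹ := by field_simp
  have e2 : (X / p)⁻¹ = X⁻¹ * p := by field_simp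
  have e3 : γ * δ * p * (X / p) = γ * δ * X := by field_simp
  have e4 : γ * δ * X * p = γ * δ * p * X := by ring
  have e5 : γ * δ * p * (p * X) = γ * δ * p * X * p := by ring
  unfold racahB racahD
  rw [e2, e3, e5]
  generalize hd0 : 1 - γ * δ * X ^ 2 = d0 at *
  generalize hd1 : 1 - γ * δ * p * X ^ 2 = d1 at *
  generalize hd2 : 1 - γ * δ * p ^ 2 * X ^ 2 = d2 at *
  cases l with
  | zero =>
    simp only [qPoch_succ, qPoch_zero, zero_add, pow_zero, pow_one, mul_one, one_mul]
    field_simp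
    subst hd0 hd1 hd2
    ring
  | succ m =>
    have a1 : qPoch (p * X)⁻¹ p (m + 1 + 1) =
        (1 - (p * X)⁻¹) * ((1 - X⁻¹) * qPoch (X⁻¹ * p) p m) := by
      rw [qPoch_succ', e1, qPoch_succ']
    have a2 : qPoch X⁻¹ p (m + 1) = (1 - X⁻¹) * qPoch (X⁻¹ * p) p m := qPoch_succ' ..
    have a3 : qPoch X⁻¹ p (m + 1 + 1) =
        (1 - X⁻¹) * qPoch (X⁻¹ * p) p m * (1 - X⁻¹ * p ^ (m + 1)) := by
      rw [qPoch_succ, a2]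
    have a4 : qPoch (X⁻¹ * p) p (m + 1 + 1) =
        qPoch (X⁻¹ * p) p m * (1 - X⁻¹ * p * p ^ m) * (1 - X⁻¹ * p * p ^ (m + 1)) := by
      rw [qPoch_succ, qPoch_succ]
    have b1 : qPoch (γ * δ * X) p (m + 1 + 1) =
        (1 - γ * δ * X) * ((1 - γ * δ * p * X) * qPoch (γ * δ * p * X * p) p m) := by
      rw [qPoch_succ', e4, qPoch_succ']
    have b2 : qPoch (γ * δ * p * X) p (m + 1) =
        (1 - γ * δ * p * X) * qPoch (γ * δ * p * X * p) p m := qPoch_succ' ..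
    have b3 : qPoch (γ * δ * p * X) p (m + 1 + 1) =
        (1 - γ * δ * p * X) * qPoch (γ * δ * p * X * p) p m *
          (1 - γ * δ * p * X * p ^ (m + 1)) := by
      rw [qPoch_succ, b2]
    have b4 : qPoch (γ * δ * p * X * p) p (m + 1 + 1) =
        qPoch (γ * δ * p * X * p) p m * (1 - γ * δ * p * X * p * p ^ m) *
          (1 - γ * δ * p * X * p * p ^ (m + 1)) := by
      rw [qPoch_succ, qPoch_succ]
    rw [a1, a3, a2, a4, b1, b3, b2, b4]
    generalize qPoch (γ * δ * p * X * p) p m = Y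
    generalize qPoch (X⁻¹ * p) p m = Z
    simp only [pow_succ]
    have hPm : p ^ m ≠ 0 := pow_ne_zero m hp
    generalize p ^ m = P at *
    field_simp
    subst hd0 hd1 hd2
    ring

/-- The `q`-difference equation of the `q`-Racah polynomials. -/
theorem racah_difference {α β γ δ p X : ℝ} (h₀ : 0 < p) (hp1 : p < 1) (hX : X ≠ 0)
    (h0 : 1 - γ * δ * X ^ 2 ≠ 0) (h1 : 1 - γ * δ * p * X ^ 2 ≠ 0)
    (h2 : 1 - γ * δ * p ^ 2 * X ^ 2 ≠ 0) (n : ℕ)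
    (hα : qPoch (α * p) p n ≠ 0) (hβ : qPoch (β * δ * p) p n ≠ 0) (hγ : qPoch (γ * p) p n ≠ 0) :
    racahB α β γ δ p X * (qRacahFun n α β γ δ p (p * X) - qRacahFun n α β γ δ p X) -
      racahD α β γ δ p X * (qRacahFun n α β γ δ p X - qRacahFun n α β γ δ p (X / p)) =
      (p ^ n)⁻¹ * (1 - p ^ n) * (1 - α * β * p ^ (n + 1)) * qRacahFun n α β γ δ p X := by
  have hp := h₀.ne'
  have hP := qPoch_self_ne_zero h₀ hp1
  set u : ℕ → ℝ := fun l => qPoch (p ^ n)⁻¹ p l * qPoch (α * β * p ^ (n + 1)) p l /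
    (qPoch (α * p) p l * qPoch (β * δ * p) p l * qPoch (γ * p) p l * qPoch p p l) * p ^ l with hu
  have hsum (Y : ℝ) : qRacahFun n α β γ δ p Y =
      ∑ l ∈ Finset.range (n + 1), u l * (qPoch Y⁻¹ p l * qPoch (γ * δ * p * Y) p l) := by
    rw [qRacahFun, phi43]
    refine Finset.sum_congr rfl fun l _ => ?_
    rw [hu, rpow_neg_natCast h₀]
    ring
  set T : ℕ → ℝ → ℝ := fun l Y => qPoch Y⁻¹ p l * qPoch (γ * δ * p * Y) p l with hT
  set E : ℕ → ℝ := fun l => (p ^ l)⁻¹ * (1 - p ^ l) * (1 - α * β * p ^ (l + 1)) with hE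
  set F : ℕ → ℝ := fun l => (p ^ l)⁻¹ * (1 - p ^ l) *
    ((1 - α * p ^ l) * (1 - β * δ * p ^ l) * (1 - γ * p ^ l)) with hF
  have hstep (l : ℕ) : racahB α β γ δ p X * (T (l + 1) (p * X) - T (l + 1) X) -
      racahD α β γ δ p X * (T (l + 1) X - T (l + 1) (X / p)) =
      E (l + 1) * T (l + 1) X - F (l + 1) * T l X := by
    rw [hT, hE, hF]
    simp only
    rw [racah_difference_basis hp hX h0 h1 h2 l]
    ring
  -- The coefficients satisfy the two-term recursion that makes the sum an eigenfunction.
  have hrec : ∀ l < n, u l * (E l - E n) = u (l + 1) * F (l + 1) := by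
    intro l hl
    obtain ⟨r, rfl⟩ := Nat.exists_eq_add_of_lt hl
    have a1 := hα
    have a2 := hβ
    have a3 := hγ
    rw [add_assoc, add_comm r 1, ← add_assoc] at a1 a2 a3
    replace a1 := qPoch_left_ne_zero a1
    replace a2 := qPoch_left_ne_zero a2
    replace a3 := qPoch_left_ne_zero a3
    have a4 := hP (l + 1)
    simp only [hu, hE, hF]
    rw [qPoch_succ] at a1 a2 a3 a4
    simp only [qPoch_succ _ _ l]
    have c1 := left_ne_zero_of_mul a1
    have c2 := left_ne_zero_of_mul a2
    have c3 := left_ne_zero_of_mul a3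
    have c4 := left_ne_zero_of_mul a4
    have d1 := right_ne_zero_of_mul a1
    have d2 := right_ne_zero_of_mul a2
    have d3 := right_ne_zero_of_mul a3
    have d4 := right_ne_zero_of_mul a4
    have hl0 : p ^ l ≠ 0 := pow_ne_zero l hp
    have hr0 : p ^ r ≠ 0 := pow_ne_zero r hp
    generalize qPoch (p ^ (l + r + 1))⁻¹ p l = Q1
    generalize qPoch (α * β * p ^ (l + r + 1 + 1)) p l = Q2
    simp only [pow_succ, pow_add, pow_zero, one_mul] at *
    generalize qPoch (α * p) p l = Q3 at *
    generalize qPoch (β * δ * p) p l = Q4 at *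
    generalize qPoch (γ * p) p l = Q5 at *
    generalize qPoch p p l = Q6 at *
    generalize p ^ l = L at *
    generalize p ^ r = R at *
    clear_value T
    clear hstep hsum hP hF hE hT hu hα hβ hγ
    have k1 : (1 - L * p) = 1 - p * L := by ring
    have k2 : (1 - α * (L * p)) = 1 - α * p * L := by ring
    have k3 : (1 - β * δ * (L * p)) = 1 - β * δ * p * L := by ring
    have k4 : (1 - γ * (L * p)) = 1 - γ * p * L := by ring
    rw [k1, k2, k3, k4]
    generalize 1 - p * L = S1 at *
    generalize 1 - α * p * L = S2 at *
    generalize 1 - β * δ * p * L = S3 at *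
    generalize 1 - γ * p * L = S4 at *
    field_simp
    ring
  rw [hsum, hsum, hsum]
  change racahB α β γ δ p X * (∑ l ∈ Finset.range (n + 1), u l * T l (p * X) -
      ∑ l ∈ Finset.range (n + 1), u l * T l X) - racahD α β γ δ p X *
      (∑ l ∈ Finset.range (n + 1), u l * T l X - ∑ l ∈ Finset.range (n + 1), u l * T l (X / p)) =
      E n * ∑ l ∈ Finset.range (n + 1), u l * T l X
  have hT0 (Y : ℝ) : T 0 Y = 1 := by simp [hT]
  have hE0 : E 0 = 0 := by simp [hE]
  have hL : racahB α β γ δ p X * (∑ l ∈ Finset.range (n + 1), u l * T l (p * X) -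
      ∑ l ∈ Finset.range (n + 1), u l * T l X) - racahD α β γ δ p X *
      (∑ l ∈ Finset.range (n + 1), u l * T l X - ∑ l ∈ Finset.range (n + 1), u l * T l (X / p)) =
      ∑ l ∈ Finset.range n, u (l + 1) * (E (l + 1) * T (l + 1) X - F (l + 1) * T l X) := by
    rw [← Finset.sum_sub_distrib, ← Finset.sum_sub_distrib, Finset.mul_sum, Finset.mul_sum,
      ← Finset.sum_sub_distrib, Finset.sum_range_succ']
    simp only [hT0, sub_self, mul_zero, add_zero]
    refine Finset.sum_congr rfl fun l _ => ?_
    rw [← hstep l]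
    ring
  have hM : ∑ l ∈ Finset.range n, u (l + 1) * (E (l + 1) * T (l + 1) X) =
      ∑ l ∈ Finset.range (n + 1), u l * (E l * T l X) := by
    rw [Finset.sum_range_succ']
    simp [hE0]
  rw [hL]
  simp only [mul_sub]
  rw [Finset.sum_sub_distrib, hM, Finset.mul_sum, sub_eq_iff_eq_add', ← sub_eq_iff_eq_add,
    ← Finset.sum_sub_distrib, Finset.sum_range_succ]
  have htop : u n * (E n * T n X) - E n * (u n * T n X) = 0 := by ring
  rw [htop, add_zero]
  refine Finset.sum_congr rfl fun l hl => ?_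
  linear_combination T l X * hrec l (Finset.mem_range.1 hl)

/-- Duality: exchanging degree and variable in a terminating `₄φ₃`. -/
lemma phi43_comm_of_terminating {p : ℝ} (h₀ : 0 < p) (n m : ℕ) (a c d e f : ℝ) :
    phi43 n a (p ^ (-(m : ℝ))) c d e f p = phi43 m c (p ^ (-(n : ℝ))) a d e f p := by
  have ext (k N : ℕ) (a b c : ℝ) : k ≤ N → phi43 k a b c d e f p =
      ∑ l ∈ Finset.range (N + 1),
        (qPoch (p ^ k)⁻¹ p l * qPoch a p l * qPoch b p l * qPoch c p l) /
        (qPoch d p l * qPoch e p l * qPoch f p l * qPoch p p l) * p ^ l := by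
    intro hk
    rw [phi43, rpow_neg_natCast h₀]
    refine Finset.sum_subset (Finset.range_mono (by omega)) fun l _ hl => ?_
    rw [qPoch_inv_pow_eq_zero h₀.ne' (by simpa [Nat.lt_succ_iff] using hl)]
    simp
  rw [ext n (max n m) _ _ _ (le_max_left ..), ext m (max n m) _ _ _ (le_max_right ..)]
  refine Finset.sum_congr rfl fun l _ => ?_
  rw [rpow_neg_natCast h₀, rpow_neg_natCast h₀]
  ring

/-! ### The matrix entries as rational functions -/

/-- The forward coefficient of the `q`-difference equation, as a rational function of `s = q^β₀`,
`n = q^N`, `P₁ = sinh_q(α₁)`, `P₂ = cosh_q(α₂)` and `u = q^x`, where `sinh_q(x)` is the eigenvalue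
of `L`. Apart from `u`, the parameters `α₁` and `α₂` enter only through `P₁` and `P₂`. -/
noncomputable def modelB (q s n P₁ P₂ u : ℝ) : ℝ :=
  (1 + s * u * q * P₂ + s ^ 2 * u ^ 2 * q ^ 2) * (1 + P₁ * (u / n) - (u / n) ^ 2) /
    ((1 + u ^ 2) * (1 + u ^ 2 * q ^ 2))

/-- The backward coefficient, in the variables of `modelB`. -/
noncomputable def modelD (q s n P₁ P₂ u : ℝ) : ℝ :=
  -((1 + P₁ * (n * u) - (n * u) ^ 2) * (s ^ 2 * q ^ 2 - s * q * u * P₂ + u ^ 2)) /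
    (n ^ 2 * ((q ^ 2 + u ^ 2) * (1 + u ^ 2)))

/-- A diagonal entry of the second Askey–Wilson relation, with the expected diagonal entry of `K`
inserted. -/
lemma model_diag {q s n u : ℝ} (hq : q ≠ 0) (hs : s ≠ 0) (hn : n ≠ 0) (hu : u ≠ 0) (P₁ P₂ : ℝ) :
    (s / n - n / s + n / s * (modelB q s n P₁ P₂ u + modelD q s n P₁ P₂ u)) *
      ((q ^ 2 + (q ^ 2)⁻¹ - 2) * (u - u⁻¹) ^ 2 + (q + q⁻¹) ^ 2 * (q - q⁻¹) ^ 2) =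
    (q - q⁻¹) ^ 2 * ((s - s⁻¹) * P₁ - P₂ * (q * n + (q * n)⁻¹)) * (u - u⁻¹) +
      (q + q⁻¹) * ((s - s⁻¹) * (q * n + (q * n)⁻¹) * (q - q⁻¹) ^ 2 +
        (q - q⁻¹) ^ 2 * (P₁ * P₂)) := by
  have h1 : 1 + u ^ 2 ≠ 0 := by positivity
  have h2 : 1 + u ^ 2 * q ^ 2 ≠ 0 := by positivity
  have h3 : q ^ 2 + u ^ 2 ≠ 0 := by positivity
  unfold modelB modelD
  field_simp
  ring

/-- A diagonal entry of the first Askey–Wilson relation, with the expected diagonal entry of `K` and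
the expected products of opposite off-diagonal entries inserted. The neighbours of the eigenvalue
parameter `u` are `q²u` and `u/q²`. -/
lemma model_offdiag {q s n u : ℝ} (hq : q ≠ 0) (hs : s ≠ 0) (hn : n ≠ 0) (hu : u ≠ 0) (P₁ P₂ : ℝ) :
    (n / s) ^ 2 * (modelB q s n P₁ P₂ u * modelD q s n P₁ P₂ (q ^ 2 * u)) *
        ((q ^ 2 + (q ^ 2)⁻¹) * (q ^ 2 * u - (q ^ 2 * u)⁻¹) - 2 * (u - u⁻¹)) +
      (n / s) ^ 2 * (modelB q s n P₁ P₂ (u / q ^ 2) * modelD q s n P₁ P₂ u) *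
        ((q ^ 2 + (q ^ 2)⁻¹) * (u / q ^ 2 - (u / q ^ 2)⁻¹) - 2 * (u - u⁻¹)) +
      (s / n - n / s + n / s * (modelB q s n P₁ P₂ u + modelD q s n P₁ P₂ u)) ^ 2 *
        ((q ^ 2 + (q ^ 2)⁻¹ - 2) * (u - u⁻¹)) =
    (q - q⁻¹) ^ 2 * ((s - s⁻¹) * P₁ - P₂ * (q * n + (q * n)⁻¹)) *
        (s / n - n / s + n / s * (modelB q s n P₁ P₂ u + modelD q s n P₁ P₂ u)) -
      (q + q⁻¹) ^ 2 * (q - q⁻¹) ^ 2 * (u - u⁻¹) +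
      (q + q⁻¹) * (P₁ * (q * n + (q * n)⁻¹) * (q - q⁻¹) ^ 2 +
        (q - q⁻¹) ^ 2 * ((s - s⁻¹) * P₂)) := by
  have h1 : 1 + u ^ 2 ≠ 0 := by positivity
  have h2 : 1 + u ^ 2 * q ^ 2 ≠ 0 := by positivity
  have h3 : q ^ 2 + u ^ 2 ≠ 0 := by positivity
  -- the two outer denominators cancel against the coefficients of the off-diagonal products
  have hc1 : (q ^ 2 + (q ^ 2)⁻¹) * (q ^ 2 * u - (q ^ 2 * u)⁻¹) - 2 * (u - u⁻¹) =
      (q ^ 4 - 1) * (1 + u ^ 2 * q ^ 4) / (u * q ^ 4) := by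
    field_simp
    ring
  have hc2 : (q ^ 2 + (q ^ 2)⁻¹) * (u / q ^ 2 - (u / q ^ 2)⁻¹) - 2 * (u - u⁻¹) =
      -(q ^ 4 - 1) * (q ^ 4 + u ^ 2) / (u * q ^ 4) := by
    field_simp
    ring
  have h4 : 1 + u ^ 2 * q ^ 4 ≠ 0 := by positivity
  have h5 : q ^ 4 + u ^ 2 ≠ 0 := by positivity
  have hD : modelD q s n P₁ P₂ (q ^ 2 * u) * (1 + u ^ 2 * q ^ 4) =
      -((1 + P₁ * (n * (q ^ 2 * u)) - (n * (q ^ 2 * u)) ^ 2) *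
        (s ^ 2 - s * q * u * P₂ + q ^ 2 * u ^ 2)) / (n ^ 2 * (1 + u ^ 2 * q ^ 2)) := by
    unfold modelD
    have h6 : q ^ 2 + (q ^ 2 * u) ^ 2 = q ^ 2 * (1 + u ^ 2 * q ^ 2) := by ring
    have h7 : 1 + (q ^ 2 * u) ^ 2 = 1 + u ^ 2 * q ^ 4 := by ring
    rw [h6, h7]
    field_simp
  have hB : modelB q s n P₁ P₂ (u / q ^ 2) * (q ^ 4 + u ^ 2) =
      (q ^ 2 + s * u * q * P₂ + s ^ 2 * u ^ 2) * q ^ 4 *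
        (1 + P₁ * (u / q ^ 2 / n) - (u / q ^ 2 / n) ^ 2) / (q ^ 2 + u ^ 2) := by
    unfold modelB
    have h6 : 1 + (u / q ^ 2) ^ 2 = (q ^ 4 + u ^ 2) / q ^ 4 := by field_simp
    have h7 : 1 + (u / q ^ 2) ^ 2 * q ^ 2 = (q ^ 2 + u ^ 2) / q ^ 2 := by field_simp
    rw [h6, h7]
    field_simp
  have g1 : (n / s) ^ 2 * (modelB q s n P₁ P₂ u * modelD q s n P₁ P₂ (q ^ 2 * u)) *
      ((q ^ 4 - 1) * (1 + u ^ 2 * q ^ 4) / (u * q ^ 4)) = (n / s) ^ 2 * modelB q s n P₁ P₂ u *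
        ((q ^ 4 - 1) / (u * q ^ 4)) * (modelD q s n P₁ P₂ (q ^ 2 * u) * (1 + u ^ 2 * q ^ 4)) := by
    ring
  have g2 : (n / s) ^ 2 * (modelB q s n P₁ P₂ (u / q ^ 2) * modelD q s n P₁ P₂ u) *
      (-(q ^ 4 - 1) * (q ^ 4 + u ^ 2) / (u * q ^ 4)) = -(n / s) ^ 2 * modelD q s n P₁ P₂ u *
        ((q ^ 4 - 1) / (u * q ^ 4)) * (modelB q s n P₁ P₂ (u / q ^ 2) * (q ^ 4 + u ^ 2)) := by
    ring
  rw [hc1, hc2, g1, g2, hD, hB]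
  unfold modelB modelD
  generalize hd1 : 1 + u ^ 2 = d1 at *
  generalize hd2 : 1 + u ^ 2 * q ^ 2 = d2 at *
  generalize hd3 : q ^ 2 + u ^ 2 = d3 at *
  field_simp
  subst hd1 hd2 hd3
  ring

/-! ### The `q`-Racah polynomials of one Askey–Wilson relation -/

/-- The univariate `q`-Racah polynomial attached to one Askey–Wilson relation with parameters
`sinh_q(β₀)`, `sinh_q(α₁)`, `cosh_q(α₂)`, `cosh_q(-N-1)`. -/
noncomputable def awRacah (q β₀ α₁ α₂ : ℝ) (N k j : ℕ) : ℝ :=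
  qRacah k j (-q ^ (β₀ + α₁ + α₂ - N - 1)) (q ^ (β₀ - α₁ - α₂ - N - 1))
    (q ^ (-2 * (N : ℝ) - 2)) (-q ^ (2 * α₁)) (q ^ 2)

/-- The forward coefficient of the `q`-difference equation of `awRacah` at `j`. -/
noncomputable def awB (q β₀ α₁ α₂ : ℝ) (N j : ℕ) : ℝ :=
  racahB (-q ^ (β₀ + α₁ + α₂ - N - 1)) (q ^ (β₀ - α₁ - α₂ - N - 1))
    (q ^ (-2 * (N : ℝ) - 2)) (-q ^ (2 * α₁)) (q ^ 2) ((q ^ 2) ^ j)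

/-- The backward coefficient of the `q`-difference equation of `awRacah` at `j`. -/
noncomputable def awD (q β₀ α₁ α₂ : ℝ) (N j : ℕ) : ℝ :=
  racahD (-q ^ (β₀ + α₁ + α₂ - N - 1)) (q ^ (β₀ - α₁ - α₂ - N - 1))
    (q ^ (-2 * (N : ℝ) - 2)) (-q ^ (2 * α₁)) (q ^ 2) ((q ^ 2) ^ j)

lemma rpow_alpha {q : ℝ} (hq : 0 < q) (β₀ α₁ α₂ : ℝ) (N : ℕ) :
    -q ^ (β₀ + α₁ + α₂ - N - 1) =
    -(q ^ β₀ * q ^ α₁ * q ^ α₂ / (q ^ N * q)) := by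
  rw [Real.rpow_sub hq, Real.rpow_sub hq, Real.rpow_add hq, Real.rpow_add hq, Real.rpow_natCast,
    Real.rpow_one, div_div]

lemma rpow_beta {q : ℝ} (hq : 0 < q) (β₀ α₁ α₂ : ℝ) (N : ℕ) :
    q ^ (β₀ - α₁ - α₂ - N - 1) =
    q ^ β₀ / (q ^ α₁ * q ^ α₂ * q ^ N * q) := by
  rw [Real.rpow_sub hq, Real.rpow_sub hq, Real.rpow_sub hq, Real.rpow_sub hq, Real.rpow_natCast,
    Real.rpow_one]
  field_simp

lemma rpow_gamma {q : ℝ} (hq : 0 < q) (N : ℕ) : q ^ (-2 * (N : ℝ) - 2) = 1 / (q ^ N * q) ^ 2 := by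
  rw [show -2 * (N : ℝ) - 2 = -((2 * (N + 1) : ℕ) : ℝ) by push_cast; ring, Real.rpow_neg hq.le,
    Real.rpow_natCast, ← pow_succ, ← pow_mul, mul_comm, one_div]

lemma rpow_delta {q : ℝ} (hq : 0 < q) (α₁ : ℝ) : -q ^ (2 * α₁) = -(q ^ α₁) ^ 2 := by
  rw [mul_comm, Real.rpow_mul hq.le, Real.rpow_ofNat]

lemma sinhq_eq {q : ℝ} (hq : 0 < q) (x : ℝ) : sinhq q x = q ^ x - (q ^ x)⁻¹ := by
  rw [sinhq, Real.rpow_neg hq.le]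

lemma coshq_eq {q : ℝ} (hq : 0 < q) (x : ℝ) : coshq q x = q ^ x + (q ^ x)⁻¹ := by
  rw [coshq, Real.rpow_neg hq.le]

lemma rpow_idx {q : ℝ} (hq : 0 < q) (α₁ : ℝ) (N j : ℕ) :
    q ^ (2 * idx N j + α₁) = (q ^ 2) ^ j * q ^ α₁ / q ^ N := by
  rw [idx, Real.rpow_add hq, show 2 * ((j : ℝ) - N / 2) = ((2 * j : ℕ) : ℝ) - N by push_cast; ring,
    Real.rpow_sub hq, Real.rpow_natCast, Real.rpow_natCast, pow_mul]
  ring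

lemma awB_eq_modelB {q : ℝ} (hq : 0 < q) (β₀ α₁ α₂ : ℝ) (N j : ℕ) :
    awB q β₀ α₁ α₂ N j =
    modelB q (q ^ β₀) (q ^ N) (sinhq q α₁) (coshq q α₂) (q ^ (2 * idx N j + α₁)) := by
  rw [awB, rpow_alpha hq, rpow_beta hq, rpow_gamma hq, rpow_delta hq, rpow_idx hq, sinhq_eq hq,
    coshq_eq hq]
  have hs := (Real.rpow_pos_of_pos hq β₀)
  have ht := (Real.rpow_pos_of_pos hq α₂)
  have ha := (Real.rpow_pos_of_pos hq α₁)
  have hn := pow_pos hq N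
  have hX : 0 < (q ^ 2) ^ j := by positivity
  generalize q ^ β₀ = s at *
  generalize q ^ α₂ = t at *
  generalize q ^ α₁ = a at *
  generalize q ^ N = n at *
  generalize (q ^ 2) ^ j = X at *
  unfold racahB modelB
  have h1 : 1 - 1 / (n * q) ^ 2 * -a ^ 2 * q ^ 2 * X ^ 2 = 1 + (X * a / n) ^ 2 := by
    field_simp
    ring
  have h2 : 1 - 1 / (n * q) ^ 2 * -a ^ 2 * (q ^ 2) ^ 2 * X ^ 2 = 1 + (X * a / n) ^ 2 * q ^ 2 := by
    field_simp
    ring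
  rw [h1, h2]
  congr 1
  field_simp
  ring

lemma awD_eq_modelD {q : ℝ} (hq : 0 < q) (β₀ α₁ α₂ : ℝ) (N j : ℕ) :
    awD q β₀ α₁ α₂ N j =
    modelD q (q ^ β₀) (q ^ N) (sinhq q α₁) (coshq q α₂) (q ^ (2 * idx N j + α₁)) := by
  rw [awD, rpow_alpha hq, rpow_beta hq, rpow_gamma hq, rpow_delta hq, rpow_idx hq, sinhq_eq hq,
    coshq_eq hq]
  have hs := (Real.rpow_pos_of_pos hq β₀)
  have ht := (Real.rpow_pos_of_pos hq α₂)
  have ha := (Real.rpow_pos_of_pos hq α₁)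
  have hn := pow_pos hq N
  have hX : 0 < (q ^ 2) ^ j := by positivity
  generalize q ^ β₀ = s at *
  generalize q ^ α₂ = t at *
  generalize q ^ α₁ = a at *
  generalize q ^ N = n at *
  generalize (q ^ 2) ^ j = X at *
  unfold racahD modelD
  have h1 : 1 - 1 / (n * q) ^ 2 * -a ^ 2 * q ^ 2 * X ^ 2 = 1 + (X * a / n) ^ 2 := by
    field_simp
    ring
  have h2 : 1 - 1 / (n * q) ^ 2 * -a ^ 2 * X ^ 2 = (q ^ 2 + (X * a / n) ^ 2) / q ^ 2 := by
    field_simp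
    ring
  have h3 : 0 < 1 + (X * a / n) ^ 2 := by positivity
  have h4 : 0 < q ^ 2 + (X * a / n) ^ 2 := by positivity
  rw [h1, h2]
  generalize 1 + (X * a / n) ^ 2 = d1 at *
  generalize q ^ 2 + (X * a / n) ^ 2 = d2 at *
  field_simp
  ring

/-- The forward coefficient vanishes at the right end of the spectrum. -/
lemma awB_self {q : ℝ} (hq : 0 < q) (β₀ α₁ α₂ : ℝ) (N : ℕ) : awB q β₀ α₁ α₂ N N = 0 := by
  rw [awB, racahB, rpow_gamma hq]
  have : 1 - 1 / (q ^ N * q) ^ 2 * q ^ 2 * (q ^ 2) ^ N = 0 := by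
    rw [← pow_mul, mul_comm 2 N, pow_mul]
    have := pow_pos hq N
    field_simp
    ring
  rw [this]
  simp

/-- The backward coefficient vanishes at the left end of the spectrum. -/
lemma awD_zero (q β₀ α₁ α₂ : ℝ) (N : ℕ) : awD q β₀ α₁ α₂ N 0 = 0 := by
  simp [awD, racahD]

lemma awB_ne_zero {q : ℝ} (hq : 0 < q) (hq1 : q < 1) (β₀ α₁ α₂ : ℝ) {N j : ℕ} (hj : j < N) :
    awB q β₀ α₁ α₂ N j ≠ 0 := by
  rw [awB, racahB]
  have hα := Real.rpow_pos_of_pos hq (β₀ + α₁ + α₂ - N - 1)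
  have hβ := Real.rpow_pos_of_pos hq (β₀ - α₁ - α₂ - N - 1)
  have hγ := Real.rpow_pos_of_pos hq (-2 * (N : ℝ) - 2)
  have hδ := Real.rpow_pos_of_pos hq (2 * α₁)
  have hX : 0 < (q ^ 2) ^ j := by positivity
  have h3 : 1 - q ^ (-2 * (N : ℝ) - 2) * q ^ 2 * (q ^ 2) ^ j ≠ 0 := by
    obtain ⟨r, rfl⟩ := Nat.exists_eq_add_of_lt hj
    rw [rpow_gamma hq]
    have hr : (q ^ (r + 1)) ^ 2 ≠ 1 := by
      rw [← pow_mul]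
      exact (pow_lt_one₀ hq.le hq1 (by positivity)).ne
    intro h
    apply hr
    have hjp := pow_pos hq j
    have hrp := pow_pos hq r
    rw [add_assoc, pow_add, ← pow_mul, mul_comm 2 j, pow_mul] at h
    have hr1 := pow_pos hq (r + 1)
    field_simp at h
    linear_combination h
  have h1 : 1 - -q ^ (β₀ + α₁ + α₂ - N - 1) * q ^ 2 * (q ^ 2) ^ j ≠ 0 := by
    simp only [neg_mul, sub_neg_eq_add]
    positivity
  have h2 : 1 - q ^ (β₀ - α₁ - α₂ - N - 1) * -q ^ (2 * α₁) * q ^ 2 * (q ^ 2) ^ j ≠ 0 := by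
    simp only [mul_neg, neg_mul, sub_neg_eq_add]
    positivity
  have h4 : 1 - q ^ (-2 * (N : ℝ) - 2) * -q ^ (2 * α₁) * q ^ 2 * (q ^ 2) ^ j ≠ 0 := by
    simp only [mul_neg, neg_mul, sub_neg_eq_add]
    positivity
  have h5 : 1 - q ^ (-2 * (N : ℝ) - 2) * -q ^ (2 * α₁) * q ^ 2 * ((q ^ 2) ^ j) ^ 2 ≠ 0 := by
    simp only [mul_neg, neg_mul, sub_neg_eq_add]
    positivity
  have h6 : 1 - q ^ (-2 * (N : ℝ) - 2) * -q ^ (2 * α₁) * (q ^ 2) ^ 2 * ((q ^ 2) ^ j) ^ 2 ≠ 0 := by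
    simp only [mul_neg, neg_mul, sub_neg_eq_add]
    positivity
  positivity

/-- The two excluded values are the zeros of the factors `β - γX` and `α - γδX`; the nondegeneracy
condition keeps away from them. -/
lemma awD_ne_zero {q : ℝ} (hq : 0 < q) (hq1 : q < 1) {β₀ α₁ α₂ : ℝ} (N : ℕ) {j : ℕ}
    (hj : 1 ≤ j)
    (h₁ : β₀ - α₁ - α₂ ≠ 2 * j - N - 1) (h₂ : β₀ - α₁ + α₂ ≠ 2 * j - N - 1) :
    awD q β₀ α₁ α₂ N j ≠ 0 := by
  rw [awD, racahD]
  have hα := Real.rpow_pos_of_pos hq (β₀ + α₁ + α₂ - N - 1)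
  have hβ := Real.rpow_pos_of_pos hq (β₀ - α₁ - α₂ - N - 1)
  have hγ := Real.rpow_pos_of_pos hq (-2 * (N : ℝ) - 2)
  have hδ := Real.rpow_pos_of_pos hq (2 * α₁)
  have hX : 0 < (q ^ 2) ^ j := by positivity
  have hXr : (q ^ 2) ^ j = q ^ (2 * (j : ℝ)) := by
    rw [← pow_mul, ← Real.rpow_natCast]
    push_cast
    rfl
  have inj := (Real.strictAnti_rpow_of_base_lt_one hq hq1).injective
  have h1 : 1 - (q ^ 2) ^ j ≠ 0 := by
    rw [← pow_mul]
    exact sub_ne_zero.2 (pow_lt_one₀ hq.le hq1 (by positivity)).ne'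
  have h2 : 1 - -q ^ (2 * α₁) * (q ^ 2) ^ j ≠ 0 := by
    simp only [neg_mul, sub_neg_eq_add]
    positivity
  have h3 : q ^ (β₀ - α₁ - α₂ - N - 1) - q ^ (-2 * (N : ℝ) - 2) * (q ^ 2) ^ j ≠ 0 := by
    rw [hXr, ← Real.rpow_add hq, sub_ne_zero]
    intro h
    have := inj h
    exact h₁ (by linear_combination this)
  have h4 : -q ^ (β₀ + α₁ + α₂ - N - 1) - q ^ (-2 * (N : ℝ) - 2) * -q ^ (2 * α₁) * (q ^ 2) ^ j ≠
      0 := by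
    rw [hXr, mul_neg, neg_mul, ← Real.rpow_add hq, ← Real.rpow_add hq, sub_ne_zero]
    intro h
    have := inj (neg_injective h)
    exact h₂ (by linear_combination this)
  have h5 : 1 - q ^ (-2 * (N : ℝ) - 2) * -q ^ (2 * α₁) * ((q ^ 2) ^ j) ^ 2 ≠ 0 := by
    simp only [mul_neg, neg_mul, sub_neg_eq_add]
    positivity
  have h6 : 1 - q ^ (-2 * (N : ℝ) - 2) * -q ^ (2 * α₁) * q ^ 2 * ((q ^ 2) ^ j) ^ 2 ≠ 0 := by
    simp only [mul_neg, neg_mul, sub_neg_eq_add]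
    positivity
  positivity

lemma qPoch_neg_ne_zero {x p : ℝ} (hx : 0 < x) (hp : 0 < p) (n : ℕ) : qPoch (-x) p n ≠ 0 :=
  qPoch_ne_zero fun i _ => by
    have : 0 < x * p ^ i := by positivity
    linarith

lemma awRacah_zero_right (q β₀ α₁ α₂ : ℝ) (N k : ℕ) : awRacah q β₀ α₁ α₂ N k 0 = 1 := by
  have h : awRacah q β₀ α₁ α₂ N k 0 = qRacahFun k (-q ^ (β₀ + α₁ + α₂ - N - 1))
      (q ^ (β₀ - α₁ - α₂ - N - 1)) (q ^ (-2 * (N : ℝ) - 2)) (-q ^ (2 * α₁)) (q ^ 2) 1 := by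
    rw [awRacah, qRacah, qRacahFun]
    simp
  rw [h, qRacahFun_one]

lemma awRacah_zero_left (q β₀ α₁ α₂ : ℝ) (N j : ℕ) : awRacah q β₀ α₁ α₂ N 0 j = 1 := by
  simp [awRacah, qRacah, phi43]

/-- The three-term recurrence in `j` satisfied by the `q`-Racah polynomials: it is the eigenvalue
equation of a tridiagonal matrix with eigenvalue `sinh_q(2k - N + β₀)`. -/
theorem awRacah_recurrence {q : ℝ} (hq : 0 < q) (hq1 : q < 1) (β₀ α₁ α₂ : ℝ) {N : ℕ} (j : ℕ)
    {k : ℕ} (hk : k ≤ N) :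
    (spec q β₀ (idx N 0) + q ^ N / q ^ β₀ * (awB q β₀ α₁ α₂ N j + awD q β₀ α₁ α₂ N j)) *
        awRacah q β₀ α₁ α₂ N k j -
      q ^ N / q ^ β₀ * awB q β₀ α₁ α₂ N j * awRacah q β₀ α₁ α₂ N k (j + 1) -
      q ^ N / q ^ β₀ * awD q β₀ α₁ α₂ N j * awRacah q β₀ α₁ α₂ N k (j - 1) =
      spec q β₀ (idx N k) * awRacah q β₀ α₁ α₂ N k j := by
  have hα := Real.rpow_pos_of_pos hq (β₀ + α₁ + α₂ - N - 1)
  have hβ := Real.rpow_pos_of_pos hq (β₀ - α₁ - α₂ - N - 1)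
  have hγ := Real.rpow_pos_of_pos hq (-2 * (N : ℝ) - 2)
  have hδ := Real.rpow_pos_of_pos hq (2 * α₁)
  have hX : 0 < (q ^ 2) ^ j := by positivity
  have hp : 0 < q ^ 2 := by positivity
  have hp1 : q ^ 2 < 1 := pow_lt_one₀ hq.le hq1 two_ne_zero
  have hαn : qPoch (-q ^ (β₀ + α₁ + α₂ - N - 1) * q ^ 2) (q ^ 2) k ≠ 0 := by
    rw [neg_mul]
    exact qPoch_neg_ne_zero (by positivity) hp k
  have hβn : qPoch (q ^ (β₀ - α₁ - α₂ - N - 1) * -q ^ (2 * α₁) * q ^ 2) (q ^ 2) k ≠ 0 := by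
    rw [mul_neg, neg_mul]
    exact qPoch_neg_ne_zero (by positivity) hp k
  have hγn : qPoch (q ^ (-2 * (N : ℝ) - 2) * q ^ 2) (q ^ 2) k ≠ 0 := by
    refine qPoch_ne_zero fun i hi => ?_
    rw [rpow_gamma hq]
    obtain ⟨r, rfl⟩ := Nat.exists_eq_add_of_lt (lt_of_lt_of_le hi hk)
    have hr : (q ^ (r + 1)) ^ 2 ≠ 1 := by
      rw [← pow_mul]
      exact (pow_lt_one₀ hq.le hq1 (by positivity)).ne
    intro h
    apply hr
    have hjp := pow_pos hq i
    rw [add_assoc, pow_add, ← pow_mul, mul_comm 2 i, pow_mul] at h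
    have hr1 := pow_pos hq (r + 1)
    field_simp at h
    linear_combination -h
  have key := racah_difference (α := -q ^ (β₀ + α₁ + α₂ - N - 1)) (β := q ^ (β₀ - α₁ - α₂ - N - 1))
    (γ := q ^ (-2 * (N : ℝ) - 2)) (δ := -q ^ (2 * α₁)) (X := (q ^ 2) ^ j) hp hp1 hX.ne'
    (by simp only [mul_neg, neg_mul, sub_neg_eq_add]; positivity)
    (by simp only [mul_neg, neg_mul, sub_neg_eq_add]; positivity)
    (by simp only [mul_neg, neg_mul, sub_neg_eq_add]; positivity) k hαn hβn hγn
  have e0 : ∀ i, qRacahFun k (-q ^ (β₀ + α₁ + α₂ - N - 1)) (q ^ (β₀ - α₁ - α₂ - N - 1))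
      (q ^ (-2 * (N : ℝ) - 2)) (-q ^ (2 * α₁)) (q ^ 2) ((q ^ 2) ^ i) =
      awRacah q β₀ α₁ α₂ N k i := fun i => (qRacah_eq_qRacahFun hp k i _ _ _ _).symm
  have e1 : q ^ 2 * (q ^ 2) ^ j = (q ^ 2) ^ (j + 1) := (pow_succ' _ _).symm
  rw [e1, e0, e0] at key
  change awB q β₀ α₁ α₂ N j * _ - awD q β₀ α₁ α₂ N j * _ = _ at key
  have e2 : awD q β₀ α₁ α₂ N j * (awRacah q β₀ α₁ α₂ N k j -
      qRacahFun k (-q ^ (β₀ + α₁ + α₂ - N - 1)) (q ^ (β₀ - α₁ - α₂ - N - 1))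
      (q ^ (-2 * (N : ℝ) - 2)) (-q ^ (2 * α₁)) (q ^ 2) ((q ^ 2) ^ j / q ^ 2)) =
      awD q β₀ α₁ α₂ N j * (awRacah q β₀ α₁ α₂ N k j - awRacah q β₀ α₁ α₂ N k (j - 1)) := by
    cases j with
    | zero => rw [awD_zero, zero_mul, zero_mul]
    | succ i => rw [pow_succ (q ^ 2), mul_div_cancel_right₀ _ hp.ne', e0, Nat.add_sub_cancel]
  rw [e2] at key
  have hs := Real.rpow_pos_of_pos hq β₀
  have hn := pow_pos hq N
  have hlam : spec q β₀ (idx N k) - spec q β₀ (idx N 0) = -(q ^ N / q ^ β₀) *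
      (((q ^ 2) ^ k)⁻¹ * (1 - (q ^ 2) ^ k) * (1 - -q ^ (β₀ + α₁ + α₂ - N - 1) *
        q ^ (β₀ - α₁ - α₂ - N - 1) * (q ^ 2) ^ (k + 1))) := by
    rw [spec, spec, sinhq_eq hq, sinhq_eq hq, rpow_idx hq, rpow_idx hq, rpow_alpha hq,
      rpow_beta hq]
    have h1 := Real.rpow_pos_of_pos hq α₁
    have h2 := Real.rpow_pos_of_pos hq α₂
    have hk : 0 < (q ^ 2) ^ k := by positivity
    rw [pow_succ (q ^ 2) k, pow_zero]
    generalize (q ^ 2) ^ k = Y at *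
    field_simp
    ring
  linear_combination -(q ^ N / q ^ β₀) * key - awRacah q β₀ α₁ α₂ N k j * hlam

/-! ### Askey–Wilson pairs with one diagonal member -/

lemma sinhq_strictAnti {q : ℝ} (hq : 0 < q) (hq1 : q < 1) : StrictAnti (sinhq q) := by
  intro x y hxy
  have h := Real.strictAnti_rpow_of_base_lt_one hq hq1
  have h1 := h hxy
  have h2 := h (neg_lt_neg hxy)
  simp only [sinhq]
  linarith

lemma spec_idx_injective {q : ℝ} (hq : 0 < q) (hq1 : q < 1) (α : ℝ) (N : ℕ) :
    Function.Injective fun j : ℕ => spec q α (idx N j) := by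
  intro i j h
  have := (sinhq_strictAnti hq hq1).injective h
  simp only [idx] at this
  exact_mod_cast (by linarith : (i : ℝ) = j)

lemma map_awFst {A B : Type*} [Ring A] [Algebra ℂ A] [Ring B] [Algebra ℂ B] (f : A →ₐ[ℂ] B) (q : ℝ)
    (K L : A) (P : Fin 6 → A) :
    f (awFst q K L P) = awFst q (f K) (f L) (fun i => f (P i)) := by
  simp only [awFst, map_sub, map_add, map_mul, map_pow, map_smul]

lemma map_awSnd {A B : Type*} [Ring A] [Algebra ℂ A] [Ring B] [Algebra ℂ B] (f : A →ₐ[ℂ] B) (q : ℝ)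
    (K L : A) (P : Fin 6 → A) :
    f (awSnd q K L P) = awSnd q (f K) (f L) (fun i => f (P i)) := by
  simp only [awSnd, map_sub, map_add, map_mul, map_pow, map_smul]

/-- The six structure parameters of an Askey–Wilson relation, as scalars. -/
noncomputable def awScalars (q β₀ α₁ α₂ : ℝ) (N : ℕ) : Fin 6 → ℝ :=
  ![sinhq q β₀, sinhq q α₁, coshq q α₂, coshq q (-(N : ℝ) - 1), sinhq q 1 ^ 2, sinhq q 1 ^ 2]

section Matrix

variable {n : Type*} [Fintype n] [DecidableEq n] (q : ℝ) (A : Matrix n n ℂ) (μ : n → ℂ)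
  (p : Fin 6 → ℂ)

lemma awSnd_diagonal_apply (i j : n) :
    awSnd q A (Matrix.diagonal μ) (fun s => algebraMap ℂ _ (p s)) i j =
      (coshq q 2 * μ i * μ j - μ i ^ 2 - μ j ^ 2 + coshq q 1 ^ 2 * p 4) * A i j -
        if i = j then sinhq q 1 ^ 2 * (p 0 * p 1 - p 2 * p 3) * μ i +
          coshq q 1 * (p 0 * p 3 * p 4 + sinhq q 1 ^ 2 * (p 1 * p 2)) else 0 := by
  have e (x y : ℂ) : algebraMap ℂ (Matrix n n ℂ) x * algebraMap ℂ (Matrix n n ℂ) y =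
    algebraMap ℂ (Matrix n n ℂ) (x * y) := (map_mul _ _ _).symm
  have e' (x y : ℂ) : algebraMap ℂ (Matrix n n ℂ) x - algebraMap ℂ (Matrix n n ℂ) y =
    algebraMap ℂ (Matrix n n ℂ) (x - y) := (map_sub _ _ _).symm
  unfold awSnd
  simp only [e, e', ← Algebra.smul_def, pow_two, Matrix.diagonal_mul_diagonal, Matrix.sub_apply,
    Matrix.add_apply, Matrix.smul_apply, Matrix.mul_diagonal, Matrix.diagonal_mul,
    Matrix.diagonal_apply, Matrix.algebraMap_matrix_apply, smul_eq_mul]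
  split_ifs with h
  · subst h
    simp
    ring
  · simp
    ring

lemma awFst_diagonal_apply_self (j : n) :
    awFst q A (Matrix.diagonal μ) (fun s => algebraMap ℂ _ (p s)) j j =
      ∑ i, A j i * A i j * (coshq q 2 * μ i - 2 * μ j) -
        (sinhq q 1 ^ 2 * (p 0 * p 1 - p 2 * p 3) * A j j - coshq q 1 ^ 2 * p 5 * μ j +
          coshq q 1 * (p 1 * p 3 * p 5 + sinhq q 1 ^ 2 * (p 0 * p 2))) := by
  have e (x y : ℂ) : algebraMap ℂ (Matrix n n ℂ) x * algebraMap ℂ (Matrix n n ℂ) y =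
    algebraMap ℂ (Matrix n n ℂ) (x * y) := (map_mul _ _ _).symm
  have e' (x y : ℂ) : algebraMap ℂ (Matrix n n ℂ) x - algebraMap ℂ (Matrix n n ℂ) y =
    algebraMap ℂ (Matrix n n ℂ) (x - y) := (map_sub _ _ _).symm
  have h1 : (A * Matrix.diagonal μ * A) j j = ∑ i, A j i * A i j * μ i := by
    rw [Matrix.mul_apply]
    exact Finset.sum_congr rfl fun i _ => by rw [Matrix.mul_diagonal]; ring
  have h2 : (A * A) j j = ∑ i, A j i * A i j := Matrix.mul_apply
  unfold awFst
  simp only [e, e', ← Algebra.smul_def, pow_two A, Matrix.sub_apply,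
    Matrix.add_apply, Matrix.smul_apply, Matrix.mul_diagonal, Matrix.diagonal_mul,
    Matrix.diagonal_apply_eq, Matrix.algebraMap_matrix_apply, smul_eq_mul, h1, h2, if_true,
    Algebra.algebraMap_self, RingHom.id_apply]
  have h3 : ∑ i, A j i * A i j * (coshq q 2 * μ i - 2 * μ j) =
      coshq q 2 * (∑ i, A j i * A i j * μ i) - 2 * μ j * ∑ i, A j i * A i j := by
    rw [Finset.mul_sum, Finset.mul_sum, ← Finset.sum_sub_distrib]
    exact Finset.sum_congr rfl fun i _ => by ring
  rw [h3]
  ring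

end Matrix

/-- A sum over `Fin (N + 1)` whose terms vanish away from `j` and its two neighbours. -/
lemma sum_eq_of_tridiagonal {N : ℕ} (f : Fin (N + 1) → ℂ) (j : Fin (N + 1))
    (h : ∀ i, i ≠ j → i.val ≠ j.val + 1 → i.val + 1 ≠ j.val → f i = 0) :
    ∑ i, f i = f j + (if h : j.val + 1 < N + 1 then f ⟨j.val + 1, h⟩ else 0) +
      (if h : 0 < j.val then f ⟨j.val - 1, by omega⟩ else 0) := by
  have h1 : ∀ i, f i = (if i = j then f i else 0) + (if i.val = j.val + 1 then f i else 0) +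
      (if i.val + 1 = j.val then f i else 0) := by
    intro i
    by_cases a : i = j
    · subst a
      simp
    by_cases b : i.val = j.val + 1
    · rw [if_neg a, if_pos b, if_neg (by omega)]
      ring
    by_cases c : i.val + 1 = j.val
    · rw [if_neg a, if_neg b, if_pos c]
      ring
    rw [if_neg a, if_neg b, if_neg c, h i a b c]
    ring
  rw [Finset.sum_congr rfl fun i _ => h1 i, Finset.sum_add_distrib, Finset.sum_add_distrib]
  congr 1
  · congr 1
    · simp
    · split_ifs with hj
      · have : ∀ i : Fin (N + 1), i.val = j.val + 1 ↔ i = ⟨j.val + 1, hj⟩ := fun i => by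
          rw [Fin.ext_iff]
        simp [this]
      · exact Finset.sum_eq_zero fun i _ => if_neg (by omega)
  · split_ifs with hj
    · have : ∀ i : Fin (N + 1), i.val + 1 = j.val ↔ i = ⟨j.val - 1, by omega⟩ := fun i => by
        rw [Fin.ext_iff]
        simp only
        omega
      simp [this]
    · exact Finset.sum_eq_zero fun i _ => if_neg (by omega)

/-- The coefficient of `K i j` in entry `(i, j)` of the second relation: it vanishes only when the
arguments of the two eigenvalues differ by `2`. -/
lemma awSnd_factor {q : ℝ} (hq : 0 < q) (x y : ℝ) :
    coshq q 2 * sinhq q x * sinhq q y - sinhq q x ^ 2 - sinhq q y ^ 2 +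
        coshq q 1 ^ 2 * sinhq q 1 ^ 2 =
      -((sinhq q x - sinhq q (y + 2)) * (sinhq q x - sinhq q (y - 2))) := by
  simp only [sinhq_eq hq, coshq_eq hq, Real.rpow_add hq, Real.rpow_sub hq, Real.rpow_ofNat,
    Real.rpow_one]
  have h1 := Real.rpow_pos_of_pos hq x
  have h2 := Real.rpow_pos_of_pos hq y
  generalize q ^ x = u at *
  generalize q ^ y = v at *
  field_simp
  ring

section Pair

variable {q β₀ α₁ α₂ : ℝ} {N : ℕ} {A : Matrix (Fin (N + 1)) (Fin (N + 1)) ℂ}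

/-- The second Askey–Wilson relation makes `K` tridiagonal in the eigenbasis of `L`. -/
lemma aw_tridiagonal (hq : 0 < q) (hq1 : q < 1)
    (hS : awSnd q A (Matrix.diagonal fun j => (spec q α₁ (idx N j) : ℂ))
      (fun s => algebraMap ℂ _ (awScalars q β₀ α₁ α₂ N s : ℂ)) = 0)
    (i j : Fin (N + 1)) (h1 : i ≠ j) (h2 : i.val ≠ j.val + 1) (h3 : i.val + 1 ≠ j.val) :
    A i j = 0 := by
  have h := congrFun (congrFun hS i) j
  rw [awSnd_diagonal_apply, if_neg h1, sub_zero, Matrix.zero_apply] at h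
  refine (mul_eq_zero.1 h).resolve_left ?_
  have hf := awSnd_factor hq (2 * idx N i + α₁) (2 * idx N j + α₁)
  have inj := (sinhq_strictAnti hq hq1).injective
  have g1 : sinhq q (2 * idx N i + α₁) - sinhq q (2 * idx N j + α₁ + 2) ≠ 0 := by
    rw [sub_ne_zero]
    intro h0
    have h0' := inj h0
    simp only [idx] at h0'
    exact h2 (by exact_mod_cast (by linarith : (i.val : ℝ) = j.val + 1))
  have g2 : sinhq q (2 * idx N i + α₁) - sinhq q (2 * idx N j + α₁ - 2) ≠ 0 := by
    rw [sub_ne_zero]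
    intro h0
    have h0' := inj h0
    simp only [idx] at h0'
    exact h3 (by exact_mod_cast (by linarith : (i.val : ℝ) + 1 = j.val))
  have hne := neg_ne_zero.2 (mul_ne_zero g1 g2)
  rw [← hf] at hne
  simp only [spec, awScalars, Matrix.cons_val]
  exact_mod_cast hne

lemma spec_idx_zero (hq : 0 < q) (β₀ : ℝ) (N : ℕ) :
    spec q β₀ (idx N 0) = q ^ β₀ / q ^ N - q ^ N / q ^ β₀ := by
  rw [spec, sinhq_eq hq, rpow_idx hq]
  simp

lemma coshq_neg_sub_one (hq : 0 < q) (N : ℕ) :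
    coshq q (-(N : ℝ) - 1) = q * q ^ N + (q * q ^ N)⁻¹ := by
  rw [coshq, show -(N : ℝ) - 1 = -((N + 1 : ℕ) : ℝ) by push_cast; ring, neg_neg,
    rpow_neg_natCast hq, Real.rpow_natCast, pow_succ']
  ring

/-- The second Askey–Wilson relation determines the diagonal of `K`. -/
lemma aw_diagonal (hq : 0 < q) (hq1 : q < 1)
    (hS : awSnd q A (Matrix.diagonal fun j => (spec q α₁ (idx N j) : ℂ))
      (fun s => algebraMap ℂ _ (awScalars q β₀ α₁ α₂ N s : ℂ)) = 0) (j : Fin (N + 1)) :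
    A j j = ((spec q β₀ (idx N 0) +
      q ^ N / q ^ β₀ * (awB q β₀ α₁ α₂ N j + awD q β₀ α₁ α₂ N j) : ℝ) : ℂ) := by
  have h := congrFun (congrFun hS j) j
  rw [awSnd_diagonal_apply, if_pos rfl, Matrix.zero_apply, sub_eq_zero] at h
  have hu := Real.rpow_pos_of_pos hq (2 * idx N j + α₁)
  have hm := model_diag hq.ne' (Real.rpow_pos_of_pos hq β₀).ne' (pow_pos hq N).ne' hu.ne'
    (sinhq q α₁) (coshq q α₂)
  rw [← awB_eq_modelB hq, ← awD_eq_modelD hq, ← coshq_neg_sub_one hq, ← spec_idx_zero hq,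
    ← sinhq_eq hq, ← sinhq_eq hq] at hm
  have c2 : coshq q 2 = q ^ 2 + (q ^ 2)⁻¹ := by rw [coshq_eq hq, Real.rpow_ofNat]
  have c1 : coshq q 1 = q + q⁻¹ := by rw [coshq_eq hq, Real.rpow_one]
  have s1 : sinhq q 1 = q - q⁻¹ := by rw [sinhq_eq hq, Real.rpow_one]
  have hne : coshq q 2 * spec q α₁ (idx N j) * spec q α₁ (idx N j) - spec q α₁ (idx N j) ^ 2 -
      spec q α₁ (idx N j) ^ 2 + coshq q 1 ^ 2 * sinhq q 1 ^ 2 ≠ 0 := by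
    have hs : sinhq q 1 ≠ 0 := by
      rw [s1, sub_ne_zero]
      exact (hq1.trans (one_lt_inv₀ hq |>.2 hq1)).ne
    have h1 : coshq q 2 - 2 = sinhq q 1 ^ 2 := by
      rw [c2, s1]
      field_simp
      ring
    have h2 : coshq q 2 * spec q α₁ (idx N j) * spec q α₁ (idx N j) - spec q α₁ (idx N j) ^ 2 -
      spec q α₁ (idx N j) ^ 2 + coshq q 1 ^ 2 * sinhq q 1 ^ 2 =
      sinhq q 1 ^ 2 * (spec q α₁ (idx N j) ^ 2 + coshq q 1 ^ 2) := by
      rw [← h1]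
      ring
    have h3 : 0 < coshq q 1 := by
      rw [c1]
      positivity
    rw [h2]
    positivity
  have hne' : ((coshq q 2 * spec q α₁ (idx N j) * spec q α₁ (idx N j) - spec q α₁ (idx N j) ^ 2 -
      spec q α₁ (idx N j) ^ 2 + coshq q 1 ^ 2 * sinhq q 1 ^ 2 : ℝ) : ℂ) ≠ 0 := by
    exact_mod_cast hne
  refine mul_left_cancel₀ hne' ?_
  simp only [awScalars, Matrix.cons_val] at h
  rw [← c2, ← c1, ← s1] at hm
  have hm' := congrArg (fun r : ℝ => (r : ℂ)) hm
  simp only [spec] at h hm' ⊢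
  push_cast at h hm' ⊢
  linear_combination h - hm'

/-- The first Askey–Wilson relation determines the products of opposite off-diagonal entries
of `K`. -/
lemma aw_offdiagonal (hq : 0 < q) (hq1 : q < 1)
    (hF : awFst q A (Matrix.diagonal fun j => (spec q α₁ (idx N j) : ℂ))
      (fun s => algebraMap ℂ _ (awScalars q β₀ α₁ α₂ N s : ℂ)) = 0)
    (hS : awSnd q A (Matrix.diagonal fun j => (spec q α₁ (idx N j) : ℂ))
      (fun s => algebraMap ℂ _ (awScalars q β₀ α₁ α₂ N s : ℂ)) = 0) :
    ∀ (j : ℕ) (hj : j + 1 < N + 1), A ⟨j, by omega⟩ ⟨j + 1, hj⟩ * A ⟨j + 1, hj⟩ ⟨j, by omega⟩ =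
      (((q ^ N / q ^ β₀) ^ 2 * (awB q β₀ α₁ α₂ N j * awD q β₀ α₁ α₂ N (j + 1)) : ℝ) : ℂ) := by
  have c2 : coshq q 2 = q ^ 2 + (q ^ 2)⁻¹ := by rw [coshq_eq hq, Real.rpow_ofNat]
  have c1 : coshq q 1 = q + q⁻¹ := by rw [coshq_eq hq, Real.rpow_one]
  have s1 : sinhq q 1 = q - q⁻¹ := by rw [sinhq_eq hq, Real.rpow_one]
  have hstep (i : ℕ) : q ^ (2 * idx N (i + 1) + α₁) = q ^ 2 * q ^ (2 * idx N i + α₁) := by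
    rw [rpow_idx hq, rpow_idx hq, pow_succ]
    ring
  -- The diagonal entry of the first relation, with the contribution of the lower neighbour
  -- already evaluated.
  have main (j : ℕ) (hj : j + 1 < N + 1) (x : ℝ)
      (hx : (if h : 0 < j then
        A ⟨j, by omega⟩ ⟨j - 1, by omega⟩ * A ⟨j - 1, by omega⟩ ⟨j, by omega⟩ *
        (coshq q 2 * spec q α₁ (idx N (j - 1 : ℕ)) - 2 * spec q α₁ (idx N j)) else 0) = (x : ℂ))
      (hx' : x = (q ^ N / q ^ β₀) ^ 2 * (modelB q (q ^ β₀) (q ^ N) (sinhq q α₁) (coshq q α₂)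
        (q ^ (2 * idx N j + α₁) / q ^ 2) * awD q β₀ α₁ α₂ N j) *
        ((q ^ 2 + (q ^ 2)⁻¹) * (q ^ (2 * idx N j + α₁) / q ^ 2 -
          (q ^ (2 * idx N j + α₁) / q ^ 2)⁻¹) - 2 * sinhq q (2 * idx N j + α₁))) :
      A ⟨j, by omega⟩ ⟨j + 1, hj⟩ * A ⟨j + 1, hj⟩ ⟨j, by omega⟩ =
      (((q ^ N / q ^ β₀) ^ 2 * (awB q β₀ α₁ α₂ N j * awD q β₀ α₁ α₂ N (j + 1)) : ℝ) : ℂ) := by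
    have h := congrFun (congrFun hF ⟨j, by omega⟩) ⟨j, by omega⟩
    rw [awFst_diagonal_apply_self, sum_eq_of_tridiagonal _ ⟨j, by omega⟩
      (fun i a b c => by
        rw [aw_tridiagonal hq hq1 hS i ⟨j, by omega⟩ a b c]
        ring)] at h
    simp only [dif_pos hj, Matrix.zero_apply] at h
    rw [hx, aw_diagonal hq hq1 hS] at h
    have hu := Real.rpow_pos_of_pos hq (2 * idx N j + α₁)
    have hm := model_offdiag hq.ne' (Real.rpow_pos_of_pos hq β₀).ne' (pow_pos hq N).ne' hu.ne'
      (sinhq q α₁) (coshq q α₂)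
    rw [← awB_eq_modelB hq, ← awD_eq_modelD hq, ← hstep, ← awD_eq_modelD hq, ← coshq_neg_sub_one hq,
      ← spec_idx_zero hq, ← sinhq_eq hq, ← sinhq_eq hq, ← sinhq_eq hq, ← hx', ← c1, ← s1, ← c2]
      at hm
    have hne : coshq q 2 * sinhq q (2 * idx N (j + 1 : ℕ) + α₁) - 2 * sinhq q (2 * idx N j + α₁) ≠
        0 := by
      have e : coshq q 2 * sinhq q (2 * idx N (j + 1 : ℕ) + α₁) - 2 * sinhq q (2 * idx N j + α₁) =
          -(1 - q ^ 4) * (1 + (q ^ (2 * idx N j + α₁)) ^ 2 * q ^ 4) /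
            (q ^ (2 * idx N j + α₁) * q ^ 4) := by
        rw [c2, sinhq_eq hq, sinhq_eq hq, hstep]
        field_simp
        ring
      have h4 : 1 - q ^ 4 ≠ 0 := sub_ne_zero.2 (pow_lt_one₀ hq.le hq1 (by norm_num)).ne'
      rw [e]
      have : 0 < 1 + (q ^ (2 * idx N j + α₁)) ^ 2 * q ^ 4 := by positivity
      exact div_ne_zero (mul_ne_zero (neg_ne_zero.2 h4) this.ne') (by positivity)
    have hne' : ((coshq q 2 * sinhq q (2 * idx N (j + 1 : ℕ) + α₁) -
        2 * sinhq q (2 * idx N j + α₁) : ℝ) : ℂ) ≠ 0 := by exact_mod_cast hne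
    refine mul_right_cancel₀ hne' ?_
    rw [← Complex.ofReal_mul]
    have hm' := congrArg (fun r : ℝ => (r : ℂ)) hm
    simp only [awScalars, Matrix.cons_val, spec] at h hm'
    push_cast at h hm' ⊢
    linear_combination h - hm'
  intro j
  induction j with
  | zero =>
    intro hj
    refine main 0 hj 0 (by simp) ?_
    rw [awD_zero]
    ring
  | succ j ih =>
    intro hj
    refine main (j + 1) hj _ ?_ rfl
    rw [dif_pos (Nat.succ_pos j)]
    have ih' := ih (by omega)
    simp only [Nat.add_sub_cancel]
    rw [mul_comm (A _ _), ih', hstep, mul_div_cancel_left₀ _ (pow_ne_zero 2 hq.ne'),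
      ← awB_eq_modelB hq, ← sinhq_eq hq, ← c2]
    push_cast [spec]
    ring

end Pair

/-! ### Eigenvectors of an Askey–Wilson pair -/

section Eigen

variable {q β₀ α₁ α₂ : ℝ} {N : ℕ} {A : Matrix (Fin (N + 1)) (Fin (N + 1)) ℂ}

/-- A row of a tridiagonal matrix applied to a vector. -/
lemma mulVec_of_tridiagonal
    (hA : ∀ i j : Fin (N + 1), i ≠ j → i.val ≠ j.val + 1 → i.val + 1 ≠ j.val → A i j = 0)
    (c : Fin (N + 1) → ℂ) (j : Fin (N + 1)) :
    A.mulVec c j = A j j * c j +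
      (if h : j.val + 1 < N + 1 then A j ⟨j.val + 1, h⟩ * c ⟨j.val + 1, h⟩ else 0) +
      (if h : 0 < j.val then A j ⟨j.val - 1, by omega⟩ * c ⟨j.val - 1, by omega⟩ else 0) := by
  change ∑ i, A j i * c i = _
  rw [sum_eq_of_tridiagonal _ j]
  intro i a b c'
  rw [hA j i (Ne.symm a) (fun h => c' h.symm) (fun h => b h.symm), zero_mul]

/-- An eigenvector of a tridiagonal matrix without zeros above the diagonal vanishes if its first
coordinate does. -/
lemma eq_zero_of_tridiagonal
    (hA : ∀ i j : Fin (N + 1), i ≠ j → i.val ≠ j.val + 1 → i.val + 1 ≠ j.val → A i j = 0)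
    (hU : ∀ j (hj : j + 1 < N + 1), A ⟨j, by omega⟩ ⟨j + 1, hj⟩ ≠ 0)
    {c : Fin (N + 1) → ℂ} {x : ℂ} (hc : A.mulVec c = x • c) (h0 : c 0 = 0) : c = 0 := by
  have key : ∀ j (hj : j < N + 1), c ⟨j, hj⟩ = 0 := by
    intro j
    induction j using Nat.strong_induction_on with
    | _ j ih =>
      intro hj
      cases j with
      | zero => exact h0
      | succ j =>
        have h := congrFun hc ⟨j, by omega⟩
        rw [mulVec_of_tridiagonal hA, Pi.smul_apply, ih j (by omega) (by omega), dif_pos hj] at h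
        have h3 : (if h : 0 < j then A ⟨j, by omega⟩ ⟨j - 1, by omega⟩ * c ⟨j - 1, by omega⟩ else 0)
            = 0 := by
          split_ifs with hj0
          · rw [ih (j - 1) (by omega) (by omega), mul_zero]
          · rfl
        simp only at h
        rw [h3, mul_zero, zero_add, add_zero, smul_zero] at h
        exact (mul_eq_zero.1 h).resolve_left (hU j hj)
  funext j
  exact key j.val j.isLt

/-- The weights by which the eigenvector coordinates differ from the `q`-Racah polynomials. -/
noncomputable def eigenWeight (q β₀ α₁ α₂ : ℝ) (N : ℕ) (A : Matrix (Fin (N + 1)) (Fin (N + 1)) ℂ) :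
    ℕ → ℂ
  | 0 => 1
  | j + 1 => eigenWeight q β₀ α₁ α₂ N A j * (-(q ^ N / q ^ β₀ * awB q β₀ α₁ α₂ N j : ℝ)) /
      (if h : j + 1 < N + 1 then A ⟨j, by omega⟩ ⟨j + 1, h⟩ else 1)

/-- The eigenvectors of `K` for the eigenvalue `sinh_q(2k - N + β₀)` are the multiples of a vector
whose coordinates are `q`-Racah polynomials, up to weights independent of `k`. -/
theorem aw_matrix_eigenvector (hq : 0 < q) (hq1 : q < 1)
    (hF : awFst q A (Matrix.diagonal fun j => (spec q α₁ (idx N j) : ℂ))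
      (fun s => algebraMap ℂ _ (awScalars q β₀ α₁ α₂ N s : ℂ)) = 0)
    (hS : awSnd q A (Matrix.diagonal fun j => (spec q α₁ (idx N j) : ℂ))
      (fun s => algebraMap ℂ _ (awScalars q β₀ α₁ α₂ N s : ℂ)) = 0)
    (hnd : ∀ j : ℕ, 1 ≤ j → j ≤ N →
      β₀ - α₁ - α₂ ≠ 2 * j - N - 1 ∧ β₀ - α₁ + α₂ ≠ 2 * j - N - 1) :
    ∃ g : Fin (N + 1) → ℂ, (∀ j, g j ≠ 0) ∧ g 0 = 1 ∧ ∀ k ≤ N, ∀ c : Fin (N + 1) → ℂ,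
      A.mulVec c = (spec q β₀ (idx N k) : ℂ) • c ↔
        ∀ j, c j = c 0 * g j * awRacah q β₀ α₁ α₂ N k j := by
  have hκ : q ^ N / q ^ β₀ ≠ 0 :=
    div_ne_zero (pow_ne_zero N hq.ne') (Real.rpow_pos_of_pos hq β₀).ne'
  have hA := aw_tridiagonal hq hq1 hS
  have hoff := aw_offdiagonal hq hq1 hF hS
  have hU : ∀ j (hj : j + 1 < N + 1), A ⟨j, by omega⟩ ⟨j + 1, hj⟩ ≠ 0 := by
    intro j hj h0
    have h := hoff j hj
    rw [h0, zero_mul, eq_comm, Complex.ofReal_eq_zero] at h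
    have hd := hnd (j + 1) (by omega) (by omega)
    exact mul_ne_zero (pow_ne_zero 2 hκ) (mul_ne_zero (awB_ne_zero hq hq1 β₀ α₁ α₂ (by omega))
      (awD_ne_zero hq hq1 N (by omega) hd.1 hd.2)) h
  set g := eigenWeight q β₀ α₁ α₂ N A with hg
  have hup : ∀ j (hj : j + 1 < N + 1), A ⟨j, by omega⟩ ⟨j + 1, hj⟩ * g (j + 1) =
      -(q ^ N / q ^ β₀ * awB q β₀ α₁ α₂ N j : ℝ) * g j := by
    intro j hj
    have hUj := hU j hj
    rw [hg, eigenWeight, dif_pos hj]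
    field_simp
  have hdown : ∀ j (hj : j + 1 < N + 1), A ⟨j + 1, hj⟩ ⟨j, by omega⟩ * g j =
      -(q ^ N / q ^ β₀ * awD q β₀ α₁ α₂ N (j + 1) : ℝ) * g (j + 1) := by
    intro j hj
    refine mul_left_cancel₀ (hU j hj) ?_
    have h1 := hoff j hj
    have h2 := hup j hj
    push_cast at h1 h2 ⊢
    linear_combination g j * h1 + (q ^ N / (q ^ β₀ : ℝ) * awD q β₀ α₁ α₂ N (j + 1) : ℂ) * h2
  have hg0 : ∀ j, j < N + 1 → g j ≠ 0 := by
    intro j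
    induction j with
    | zero => exact fun _ => one_ne_zero
    | succ j ih =>
      intro hj
      have h1 := ih (by omega)
      rw [hg, eigenWeight, dif_pos hj]
      refine div_ne_zero (mul_ne_zero h1 (neg_ne_zero.2 ?_)) (hU j hj)
      exact_mod_cast mul_ne_zero hκ (awB_ne_zero hq hq1 β₀ α₁ α₂ (by omega))
  -- The weighted `q`-Racah polynomials are eigenvectors by the three-term recurrence.
  have heig : ∀ k ≤ N, A.mulVec (fun j => g j * awRacah q β₀ α₁ α₂ N k j) =
      (spec q β₀ (idx N k) : ℂ) • fun j : Fin (N + 1) => g j * awRacah q β₀ α₁ α₂ N k j := by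
    intro k hk
    funext j
    have hrec := congrArg (fun r : ℝ => (r : ℂ)) (awRacah_recurrence hq hq1 β₀ α₁ α₂ j.val hk)
    rw [mulVec_of_tridiagonal hA, aw_diagonal hq hq1 hS]
    have e1 : (if h : j.val + 1 < N + 1 then A j ⟨j.val + 1, h⟩ *
        (g (j.val + 1) * awRacah q β₀ α₁ α₂ N k (j.val + 1 : ℕ)) else 0) =
        -(q ^ N / q ^ β₀ * awB q β₀ α₁ α₂ N j : ℝ) * g j *
          awRacah q β₀ α₁ α₂ N k (j.val + 1 : ℕ) := by
      split_ifs with h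
      · rw [← hup j h]
        ring
      · rw [show j.val = N by omega, awB_self hq]
        simp
    have e2 : (if h : 0 < j.val then A j ⟨j.val - 1, by omega⟩ *
        (g (j.val - 1) * awRacah q β₀ α₁ α₂ N k (j.val - 1 : ℕ)) else 0) =
        -(q ^ N / q ^ β₀ * awD q β₀ α₁ α₂ N j : ℝ) * g j *
          awRacah q β₀ α₁ α₂ N k (j.val - 1 : ℕ) := by
      obtain ⟨j, hj⟩ := j
      cases j with
      | zero =>
        rw [awD_zero]
        simp
      | succ i =>
        simp only [Nat.succ_pos, dif_pos, Nat.add_sub_cancel]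
        rw [← hdown i hj]
        ring
    rw [e1, e2, Pi.smul_apply, smul_eq_mul]
    push_cast at hrec ⊢
    linear_combination g j * hrec
  refine ⟨fun j => g j, fun j => hg0 j j.isLt, rfl, fun k hk c => ⟨fun hc => ?_, fun hc => ?_⟩⟩
  · have h := eq_zero_of_tridiagonal hA hU (x := (spec q β₀ (idx N k) : ℂ))
      (c := c - c 0 • fun j : Fin (N + 1) => g j * (awRacah q β₀ α₁ α₂ N k j : ℂ))
      (by rw [Matrix.mulVec_sub, Matrix.mulVec_smul, hc, heig k hk, smul_sub, smul_comm])
      (by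
        have : g 0 = 1 := rfl
        simp [awRacah_zero_right, this])
    intro j
    have hj := congrFun h j
    simp only [Pi.sub_apply, Pi.smul_apply, smul_eq_mul, Pi.zero_apply, sub_eq_zero] at hj
    rw [hj]
    ring
  · have h : c = c 0 • fun j : Fin (N + 1) => g j * (awRacah q β₀ α₁ α₂ N k j : ℂ) := by
      funext j
      rw [hc j, Pi.smul_apply, smul_eq_mul, mul_assoc]
    rw [h, Matrix.mulVec_smul, heig k hk, smul_comm]

end Eigen

/-- The rank-one theorem: if `K`, `L` satisfy the Askey–Wilson relations and `L` is diagonal with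
eigenvalues `sinh_q(2j - N + α₁)` in the basis `e`, then the coordinates of the eigenvectors of `K`
are `q`-Racah polynomials up to normalization, and these eigenvectors form a basis. -/
theorem aw_pair_eigenvector {q β₀ α₁ α₂ : ℝ} {N : ℕ} (hq : 0 < q) (hq1 : q < 1)
    {V : Type*} [AddCommGroup V] [Module ℂ V] (e : Module.Basis (Fin (N + 1)) ℂ V)
    {K L : Module.End ℂ V} (hL : ∀ j, L (e j) = (spec q α₁ (idx N j) : ℂ) • e j)
    (hF : awFst q K L (fun s => algebraMap ℂ _ (awScalars q β₀ α₁ α₂ N s : ℂ)) = 0)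
    (hS : awSnd q K L (fun s => algebraMap ℂ _ (awScalars q β₀ α₁ α₂ N s : ℂ)) = 0)
    (hnd : ∀ j : ℕ, 1 ≤ j → j ≤ N →
      β₀ - α₁ - α₂ ≠ 2 * j - N - 1 ∧ β₀ - α₁ + α₂ ≠ 2 * j - N - 1) :
    (∃ b : Module.Basis (Fin (N + 1)) ℂ V,
      ∀ k, K (b k) = (spec q β₀ (idx N k) : ℂ) • b k) ∧
    ∃ g : Fin (N + 1) → ℂ, (∀ j, g j ≠ 0) ∧ ∀ k ≤ N, ∀ v, v ≠ 0 →
      K v = (spec q β₀ (idx N k) : ℂ) • v → e.repr v 0 ≠ 0 ∧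
        ∀ j, e.repr v j = e.repr v 0 * g j * awRacah q β₀ α₁ α₂ N k j := by
  set f := (LinearMap.toMatrixAlgEquiv e).toAlgHom with hf
  have hLm : f L = Matrix.diagonal fun j : Fin (N + 1) => (spec q α₁ (idx N j) : ℂ) := by
    ext i j
    change LinearMap.toMatrixAlgEquiv e L i j = _
    rw [LinearMap.toMatrixAlgEquiv_apply, hL, map_smul, Module.Basis.repr_self, Finsupp.smul_apply,
      Finsupp.single_apply, Matrix.diagonal_apply, smul_eq_mul]
    by_cases h : j = i
    · subst h; simp
    · simp [h, Ne.symm h]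
  have hF' := congrArg f hF
  have hS' := congrArg f hS
  rw [map_awFst, map_zero, hLm] at hF'
  rw [map_awSnd, map_zero, hLm] at hS'
  simp only [AlgHom.commutes] at hF' hS'
  obtain ⟨g, hg, hg1, hiff⟩ := aw_matrix_eigenvector hq hq1 hF' hS' hnd
  have hrepr (v : V) : (f K).mulVec (e.repr v) = e.repr (K v) :=
    LinearMap.toMatrix_mulVec_repr e e K v
  have hiff' : ∀ k ≤ N, ∀ v, K v = (spec q β₀ (idx N k) : ℂ) • v ↔
      ∀ j, e.repr v j = e.repr v 0 * g j * awRacah q β₀ α₁ α₂ N k j := by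
    intro k hk v
    rw [← hiff k hk, hrepr, ← e.repr.injective.eq_iff, map_smul, ← Finsupp.coe_smul,
      DFunLike.coe_fn_eq]
  refine ⟨?_, g, hg, fun k hk v hv hKv => ?_⟩
  · set w : Fin (N + 1) → V := fun k =>
      e.equivFun.symm fun j => g j * (awRacah q β₀ α₁ α₂ N k j : ℂ) with hw
    have hwr (k j) : e.repr (w k) j = g j * (awRacah q β₀ α₁ α₂ N k j : ℂ) := by
      rw [← e.equivFun_apply, hw, LinearEquiv.apply_symm_apply]
    have hw0 (k) : e.repr (w k) 0 = 1 := by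
      rw [hwr, hg1, Fin.val_zero, awRacah_zero_right]
      simp
    have hKw (k) : K (w k) = (spec q β₀ (idx N k) : ℂ) • w k :=
      (hiff' k (Nat.lt_succ_iff.1 k.isLt) (w k)).2 fun j => by rw [hwr, hw0, one_mul]
    clear_value w
    have hev (k : Fin (N + 1)) :
        Module.End.HasEigenvector K ((spec q β₀ (idx N k) : ℝ) : ℂ) (w k) := by
      refine Module.End.hasEigenvector_iff.2 ⟨Module.End.mem_eigenspace_iff.2 (hKw k), fun h => ?_⟩
      have h0 := hw0 k
      rw [h] at h0
      simp at h0
    have hli : LinearIndependent ℂ w :=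
      Module.End.eigenvectors_linearIndependent' K
        (fun k : Fin (N + 1) => ((spec q β₀ (idx N k) : ℝ) : ℂ))
        (fun i j h => Fin.ext (spec_idx_injective hq hq1 β₀ N (Complex.ofReal_injective h))) w hev
    refine ⟨basisOfLinearIndependentOfCardEqFinrank hli ?_, fun k => ?_⟩
    · rw [Module.finrank_eq_card_basis e]
    · rw [coe_basisOfLinearIndependentOfCardEqFinrank]
      exact hKw k
  · have h := (hiff' k hk v).1 hKv
    refine ⟨fun h0 => hv (e.repr.injective (Finsupp.ext fun j => ?_)), h⟩
    rw [h j, h0]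
    simp

/-! ### Reduction of `AW₂` to rank one -/

section Block

variable {V W : Type*} [AddCommGroup V] [Module ℂ V] [AddCommGroup W] [Module ℂ W]

/-- Askey–Wilson expressions are compatible with a map intertwining the generators and the
parameters. -/
lemma awFst_apply_of_intertwine (q : ℝ) (f : V →ₗ[ℂ] W) {K L : Module.End ℂ W}
    {P : Fin 6 → Module.End ℂ W} {K' L' : Module.End ℂ V} {P' : Fin 6 → Module.End ℂ V}
    (hK : ∀ v, K (f v) = f (K' v)) (hL : ∀ v, L (f v) = f (L' v))
    (hP : ∀ s v, P s (f v) = f (P' s v)) (v : V) :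
    awFst q K L P (f v) = f (awFst q K' L' P' v) := by
  simp only [awFst, pow_two K, pow_two K', LinearMap.sub_apply, LinearMap.add_apply,
    LinearMap.smul_apply, Module.End.mul_apply, hK, hL, hP, map_sub, map_add, map_smul]

lemma awSnd_apply_of_intertwine (q : ℝ) (f : V →ₗ[ℂ] W) {K L : Module.End ℂ W}
    {P : Fin 6 → Module.End ℂ W} {K' L' : Module.End ℂ V} {P' : Fin 6 → Module.End ℂ V}
    (hK : ∀ v, K (f v) = f (K' v)) (hL : ∀ v, L (f v) = f (L' v))
    (hP : ∀ s v, P s (f v) = f (P' s v)) (v : V) :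
    awSnd q K L P (f v) = f (awSnd q K' L' P' v) := by
  simp only [awSnd, pow_two L, pow_two L', LinearMap.sub_apply, LinearMap.add_apply,
    LinearMap.smul_apply, Module.End.mul_apply, hK, hL, hP, map_sub, map_add, map_smul]

/-- An operator commuting with `S` preserves the eigenspaces of `S`, here given by embeddings `f i`
with coordinate projections `π i`. -/
lemma apply_eq_of_commute {m : Type*} [Fintype m] (f : m → V →ₗ[ℂ] W) (π : m → W →ₗ[ℂ] V)
    (hsum : ∀ w, ∑ i, f i (π i w) = w) {T S : Module.End ℂ W} {μ : m → ℂ}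
    (hμ : Function.Injective μ) (hSf : ∀ i v, S (f i v) = μ i • f i v)
    (hπS : ∀ i w, π i (S w) = μ i • π i w) (hTS : S * T = T * S) (i : m) (v : V) :
    T (f i v) = f i (π i (T (f i v))) := by
  classical
  have h0 : ∀ l, l ≠ i → π l (T (f i v)) = 0 := by
    intro l hl
    have h1 : π l (S (T (f i v))) = μ i • π l (T (f i v)) := by
      rw [← Module.End.mul_apply S T, hTS, Module.End.mul_apply, hSf, map_smul, map_smul]
    rw [hπS, ← sub_eq_zero, ← sub_smul] at h1
    exact (smul_eq_zero.1 h1).resolve_left (sub_ne_zero.2 (hμ.ne hl))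
  conv_lhs => rw [← hsum (T (f i v))]
  refine Finset.sum_eq_single i (fun l _ hl => ?_) fun h => absurd (Finset.mem_univ i) h
  rw [h0 l hl, map_zero]

lemma repr_apply_of_apply_eq_smul {m : Type*} (e : Module.Basis m ℂ V) {S : V →ₗ[ℂ] V} {μ : m → ℂ}
    (h : ∀ i, S (e i) = μ i • e i) (v : V) (i : m) : e.repr (S v) i = μ i * e.repr v i := by
  have h' : e.coord i ∘ₗ S = μ i • e.coord i := by
    refine e.ext fun l => ?_
    simp only [LinearMap.comp_apply, LinearMap.smul_apply, Module.Basis.coord_apply]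
    rw [h, map_smul, Module.Basis.repr_self, Finsupp.smul_apply]
    by_cases hl : l = i
    · rw [hl]
    · rw [Finsupp.single_eq_of_ne (Ne.symm hl), smul_zero, smul_zero]
  exact LinearMap.congr_fun h' v

end Block

/-- Exchanging `K` and `L`, and with them the parameters `P₀, P₁` and `P₄, P₅`, exchanges the two
components of an Askey–Wilson relation. -/
lemma awFst_swap {A : Type*} [Ring A] [Algebra ℂ A] (q : ℝ) (K L : A) {p p' : Fin 6 → ℂ}
    (h0 : p' 0 = p 1) (h1 : p' 1 = p 0) (h2 : p' 2 = p 2) (h3 : p' 3 = p 3) (h5 : p' 5 = p 4) :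
    awFst q L K (fun s => algebraMap ℂ A (p' s)) = awSnd q K L (fun s => algebraMap ℂ A (p s)) := by
  simp only [awFst, awSnd, ← map_mul, h0, h1, h2, h3, h5, mul_comm (p 1) (p 0)]

lemma awSnd_swap {A : Type*} [Ring A] [Algebra ℂ A] (q : ℝ) (K L : A) {p p' : Fin 6 → ℂ}
    (h0 : p' 0 = p 1) (h1 : p' 1 = p 0) (h2 : p' 2 = p 2) (h3 : p' 3 = p 3) (h4 : p' 4 = p 5) :
    awSnd q L K (fun s => algebraMap ℂ A (p' s)) = awFst q K L (fun s => algebraMap ℂ A (p s)) := by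
  simp only [awFst, awSnd, ← map_mul, h0, h1, h2, h3, h4, mul_comm (p 1) (p 0)]

section Rep

variable {V₁ V₂ : Type*} [NormedAddCommGroup V₁] [InnerProductSpace ℂ V₁]
  [NormedAddCommGroup V₂] [InnerProductSpace ℂ V₂]

/-- A relation of `AW₂` holds for the operators of a representation. -/
lemma rel_apply {p : Params} (ρ : AW2 p →ₐ[ℂ] Module.End ℂ (V₁ ⊗[ℂ] V₂)) {x y : FreeAlgebra ℂ Gen}
    (h : Rel p x y) :
    (ρ.comp (RingQuot.mkAlgHom ℂ (Rel p))) x = (ρ.comp (RingQuot.mkAlgHom ℂ (Rel p))) y := by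
  rw [AlgHom.comp_apply, AlgHom.comp_apply, RingQuot.mkAlgHom_rel ℂ h]

lemma awFst_row_eq_zero {p : Params} (ρ : AW2 p →ₐ[ℂ] Module.End ℂ (V₁ ⊗[ℂ] V₂)) (i : RowIndex) :
    awFst p.q ((ρ.comp (RingQuot.mkAlgHom ℂ (Rel p))) (row p i).K)
      ((ρ.comp (RingQuot.mkAlgHom ℂ (Rel p))) (row p i).L)
      (fun s => (ρ.comp (RingQuot.mkAlgHom ℂ (Rel p))) ((row p i).P s)) = 0 := by
  rw [← map_awFst, rel_apply ρ (Rel.aw_fst i), map_zero]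

lemma awSnd_row_eq_zero {p : Params} (ρ : AW2 p →ₐ[ℂ] Module.End ℂ (V₁ ⊗[ℂ] V₂)) (i : RowIndex) :
    awSnd p.q ((ρ.comp (RingQuot.mkAlgHom ℂ (Rel p))) (row p i).K)
      ((ρ.comp (RingQuot.mkAlgHom ℂ (Rel p))) (row p i).L)
      (fun s => (ρ.comp (RingQuot.mkAlgHom ℂ (Rel p))) ((row p i).P s)) = 0 := by
  rw [← map_awSnd, rel_apply ρ (Rel.aw_snd i), map_zero]

/-- On `V₁ ⊗ ψ_{n₂}` the operators `K₂`, `L₁ ⊗ 1` form an Askey–Wilson pair, whose eigenvectors are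
described by the rank-one theorem. -/
theorem K2_eigenvectors {q α₀ α₁ α₂ : ℝ} (hq₀ : 0 < q) (hq₁ : q < 1) {N₁ N₂ : ℕ}
    (hnd : ∀ i : ℕ, i < N₁ + N₂ →
      α₀ - α₁ + α₂ ≠ N₁ + N₂ - 1 - 2 * i ∧ α₀ - α₁ - α₂ ≠ N₁ + N₂ - 1 - 2 * i)
    (ρ : AW2 (stdParams q α₀ α₁ α₂ N₁ N₂) →ₐ[ℂ] Module.End ℂ (V₁ ⊗[ℂ] V₂))
    {κ₁ ℓ₁ : V₁ →ₗ[ℂ] V₁} {κ₂ ℓ₂ : V₂ →ₗ[ℂ] V₂} (hρ : ExtendsTensor ρ κ₁ ℓ₁ κ₂ ℓ₂)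
    (φ₁ : OrthonormalBasis (Fin (N₁ + 1)) ℂ V₁)
    (hφ₁ : ∀ j, ℓ₁ (φ₁ j) = (spec q α₁ (idx N₁ j) : ℂ) • φ₁ j)
    (ψ₂ : OrthonormalBasis (Fin (N₂ + 1)) ℂ V₂)
    (hψ₂ : ∀ k, κ₂ (ψ₂ k) = (spec q α₀ (idx N₂ k) : ℂ) • ψ₂ k) (k₂ : Fin (N₂ + 1)) :
    (∃ b : Module.Basis (Fin (N₁ + 1)) ℂ V₁, ∀ k₁, ρ (AW2.gen _ .K2) (b k₁ ⊗ₜ[ℂ] ψ₂ k₂) =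
      (spec q α₀ (idx' N₁ k₁ N₂ k₂) : ℂ) • (b k₁ ⊗ₜ[ℂ] ψ₂ k₂)) ∧
    ∃ g : Fin (N₁ + 1) → ℂ, (∀ j, g j ≠ 0) ∧ ∀ (k₁ : Fin (N₁ + 1)) (v : V₁), v ≠ 0 →
      ρ (AW2.gen _ .K2) (v ⊗ₜ[ℂ] ψ₂ k₂) =
        (spec q α₀ (idx' N₁ k₁ N₂ k₂) : ℂ) • (v ⊗ₜ[ℂ] ψ₂ k₂) →
      ∃ a : ℂ, a ≠ 0 ∧ ∀ j, inner ℂ (φ₁ j) v =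
        a * g j * awRacah q (α₀ + 2 * k₂ - N₂) α₁ α₂ N₁ k₁ j := by
  set T := ρ (AW2.gen _ .K2) with hT
  set f : Fin (N₂ + 1) → V₁ →ₗ[ℂ] V₁ ⊗[ℂ] V₂ := fun k => (TensorProduct.mk ℂ V₁ V₂).flip (ψ₂ k)
    with hf
  set π : Fin (N₂ + 1) → V₁ ⊗[ℂ] V₂ →ₗ[ℂ] V₁ := fun k =>
    (TensorProduct.rid ℂ V₁).toLinearMap ∘ₗ TensorProduct.map LinearMap.id (ψ₂.toBasis.coord k)
    with hπ
  have hfa (k v) : f k v = v ⊗ₜ[ℂ] ψ₂ k := rfl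
  have hπa (k) (v : V₁) (w : V₂) : π k (v ⊗ₜ[ℂ] w) = ψ₂.toBasis.repr w k • v := by
    simp [hπ]
  have hπf (k v) : π k (f k v) = v := by
    rw [hfa, hπa, ← ψ₂.coe_toBasis, Module.Basis.repr_self, Finsupp.single_eq_same, one_smul]
  have hsum (w) : ∑ k, f k (π k w) = w := by
    induction w using TensorProduct.induction_on with
    | zero => simp
    | tmul v w =>
      simp only [hπa, hfa]
      conv_rhs => rw [← ψ₂.toBasis.sum_repr w, TensorProduct.tmul_sum]
      exact Finset.sum_congr rfl fun k _ => by
        rw [TensorProduct.smul_tmul, ψ₂.coe_toBasis]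
    | add x y hx hy =>
      simp only [map_add, Finset.sum_add_distrib, hx, hy]
  have hSf (k v) : (TensorProduct.map LinearMap.id κ₂) (f k v) =
      (spec q α₀ (idx N₂ k) : ℂ) • f k v := by
    rw [hfa, TensorProduct.map_tmul, hψ₂, TensorProduct.tmul_smul, LinearMap.id_apply]
  have hκrepr (k) (w : V₂) : ψ₂.toBasis.repr (κ₂ w) k =
      (spec q α₀ (idx N₂ k) : ℂ) * ψ₂.toBasis.repr w k :=
    repr_apply_of_apply_eq_smul ψ₂.toBasis (by simpa only [ψ₂.coe_toBasis] using hψ₂) w k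
  have hπS (k w) : π k ((TensorProduct.map LinearMap.id κ₂) w) =
      (spec q α₀ (idx N₂ k) : ℂ) • π k w := by
    induction w using TensorProduct.induction_on with
    | zero => simp
    | tmul v w =>
      rw [TensorProduct.map_tmul, hπa, hπa, hκrepr, LinearMap.id_apply, mul_smul]
    | add x y hx hy => simp only [map_add, hx, hy, smul_add]
  have hcomm : (TensorProduct.map LinearMap.id κ₂ : Module.End ℂ (V₁ ⊗[ℂ] V₂)) * T =
      T * TensorProduct.map LinearMap.id κ₂ := by
    have h := rel_apply ρ (Rel.central_K (p := stdParams q α₀ α₁ α₂ N₁ N₂) .K2_L1one 0)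
    rw [map_mul, map_mul] at h
    rw [← hρ.oneK1]
    exact h
  have hμ : Function.Injective fun k : Fin (N₂ + 1) => ((spec q α₀ (idx N₂ k) : ℝ) : ℂ) :=
    fun i j h => Fin.ext (spec_idx_injective hq₀ hq₁ α₀ N₂ (Complex.ofReal_injective h))
  set K : Module.End ℂ V₁ := π k₂ ∘ₗ T ∘ₗ f k₂ with hK
  have hTf (v) : T (f k₂ v) = f k₂ (K v) :=
    apply_eq_of_commute f π hsum hμ hSf hπS hcomm k₂ v
  have hLf (v) : ρ (AW2.gen _ .L1one) (f k₂ v) = f k₂ (ℓ₁ v) := by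
    rw [hρ.L1one]
    rfl
  have hinj : Function.Injective (f k₂) := Function.LeftInverse.injective (hπf k₂)
  -- `A₀` is replaced by the eigenvalue of `1 ⊗ K₁` on `ψ₂ k₂`, which is `sinh_q(β₀)`.
  set β₀ : ℝ := α₀ + 2 * k₂ - N₂ with hβ₀
  have hspec0 : spec q α₀ (idx N₂ k₂) = sinhq q β₀ := by
    rw [spec, idx, hβ₀]
    congr 1
    ring
  have hspec (k₁ : ℕ) : spec q β₀ (idx N₁ k₁) = spec q α₀ (idx' N₁ k₁ N₂ k₂) := by
    rw [spec, spec, idx, idx', idx, hβ₀]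
    congr 1
    ring
  let R := ρ.comp (RingQuot.mkAlgHom ℂ (Rel (stdParams q α₀ α₁ α₂ N₁ N₂)))
  have hPf : ∀ s v, R ((row (stdParams q α₀ α₁ α₂ N₁ N₂) .K2_L1one).P s) (f k₂ v) =
      f k₂ (algebraMap ℂ (Module.End ℂ V₁) (awScalars q β₀ α₁ α₂ N₁ s : ℂ) v) := by
    have hc (x : ℝ) (v : V₁) : R (row.c x) (f k₂ v) =
        f k₂ (algebraMap ℂ (Module.End ℂ V₁) (x : ℂ) v) := by
      rw [row.c, R.commutes, Module.algebraMap_end_apply, Module.algebraMap_end_apply,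
        map_smul]
    intro s v
    fin_cases s
    · change ρ (AW2.gen _ .oneK1) (f k₂ v) =
        f k₂ (algebraMap ℂ (Module.End ℂ V₁) (sinhq q β₀ : ℂ) v)
      rw [hρ.oneK1, hSf, hspec0, Module.algebraMap_end_apply, map_smul]
    · exact hc _ v
    · exact hc _ v
    · exact hc _ v
    · exact hc _ v
    · exact hc _ v
  have hF : awFst q K ℓ₁ (fun s => algebraMap ℂ _ (awScalars q β₀ α₁ α₂ N₁ s : ℂ)) = 0 := by
    ext v
    apply hinj
    rw [← awFst_apply_of_intertwine q (f k₂) hTf hLf hPf]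
    exact (LinearMap.congr_fun (awFst_row_eq_zero ρ .K2_L1one) (f k₂ v)).trans (map_zero _).symm
  have hS : awSnd q K ℓ₁ (fun s => algebraMap ℂ _ (awScalars q β₀ α₁ α₂ N₁ s : ℂ)) = 0 := by
    ext v
    apply hinj
    rw [← awSnd_apply_of_intertwine q (f k₂) hTf hLf hPf]
    exact (LinearMap.congr_fun (awSnd_row_eq_zero ρ .K2_L1one) (f k₂ v)).trans (map_zero _).symm
  have hnd' : ∀ j : ℕ, 1 ≤ j → j ≤ N₁ →
      β₀ - α₁ - α₂ ≠ 2 * j - N₁ - 1 ∧ β₀ - α₁ + α₂ ≠ 2 * j - N₁ - 1 := by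
    intro j hj1 hj2
    have h := hnd (N₁ - j + k₂) (by omega)
    push_cast [Nat.cast_sub hj2] at h
    exact ⟨fun h' => h.2 (by linear_combination h'), fun h' => h.1 (by linear_combination h')⟩
  have hφ : ∀ j, ℓ₁ (φ₁.toBasis j) = (spec q α₁ (idx N₁ j) : ℂ) • φ₁.toBasis j := by
    simpa only [φ₁.coe_toBasis] using hφ₁
  obtain ⟨⟨b, hb⟩, g, hg, hgR⟩ := aw_pair_eigenvector hq₀ hq₁ φ₁.toBasis hφ hF hS hnd'
  refine ⟨⟨b, fun k₁ => ?_⟩, g, hg, fun k₁ v hv hTv => ?_⟩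
  · rw [← hfa, hTf, hb, map_smul, hspec]
  · rw [← hfa, hTf, ← map_smul] at hTv
    obtain ⟨h0, h⟩ := hgR k₁ (Nat.lt_succ_iff.1 k₁.isLt) v hv (by rw [hspec]; exact hinj hTv)
    refine ⟨_, h0, fun j => ?_⟩
    rw [← h j, φ₁.coe_toBasis_repr_apply, φ₁.repr_apply_apply]

/-- On `φ_{m₁} ⊗ V₂` the operators `L₂`, `1 ⊗ K₁` form an Askey–Wilson pair, with the roles of `K`
and `L` exchanged. -/
theorem L2_eigenvectors {q α₀ α₁ α₂ : ℝ} (hq₀ : 0 < q) (hq₁ : q < 1) {N₁ N₂ : ℕ}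
    (hnd : ∀ i : ℕ, i < N₁ + N₂ →
      α₀ - α₁ + α₂ ≠ N₁ + N₂ - 1 - 2 * i ∧ α₀ - α₁ - α₂ ≠ N₁ + N₂ - 1 - 2 * i)
    (ρ : AW2 (stdParams q α₀ α₁ α₂ N₁ N₂) →ₐ[ℂ] Module.End ℂ (V₁ ⊗[ℂ] V₂))
    {κ₁ ℓ₁ : V₁ →ₗ[ℂ] V₁} {κ₂ ℓ₂ : V₂ →ₗ[ℂ] V₂} (hρ : ExtendsTensor ρ κ₁ ℓ₁ κ₂ ℓ₂)
    (φ₁ : OrthonormalBasis (Fin (N₁ + 1)) ℂ V₁)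
    (hφ₁ : ∀ j, ℓ₁ (φ₁ j) = (spec q α₁ (idx N₁ j) : ℂ) • φ₁ j)
    (ψ₂ : OrthonormalBasis (Fin (N₂ + 1)) ℂ V₂)
    (hψ₂ : ∀ k, κ₂ (ψ₂ k) = (spec q α₀ (idx N₂ k) : ℂ) • ψ₂ k) (j₁ : Fin (N₁ + 1)) :
    (∃ b : Module.Basis (Fin (N₂ + 1)) ℂ V₂, ∀ j₂, ρ (AW2.gen _ .L2) (φ₁ j₁ ⊗ₜ[ℂ] b j₂) =
      (spec q α₁ (idx' N₂ j₂ N₁ j₁) : ℂ) • (φ₁ j₁ ⊗ₜ[ℂ] b j₂)) ∧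
    ∃ g : Fin (N₂ + 1) → ℂ, (∀ k, g k ≠ 0) ∧ ∀ (j₂ : Fin (N₂ + 1)) (v : V₂), v ≠ 0 →
      ρ (AW2.gen _ .L2) (φ₁ j₁ ⊗ₜ[ℂ] v) =
        (spec q α₁ (idx' N₂ j₂ N₁ j₁) : ℂ) • (φ₁ j₁ ⊗ₜ[ℂ] v) →
      ∃ a : ℂ, a ≠ 0 ∧ ∀ k, inner ℂ (ψ₂ k) v =
        a * g k * awRacah q (α₁ + 2 * j₁ - N₁) α₀ (-α₂) N₂ j₂ k := by
  set T := ρ (AW2.gen _ .L2) with hT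
  set f : Fin (N₁ + 1) → V₂ →ₗ[ℂ] V₁ ⊗[ℂ] V₂ := fun j => TensorProduct.mk ℂ V₁ V₂ (φ₁ j) with hf
  set π : Fin (N₁ + 1) → V₁ ⊗[ℂ] V₂ →ₗ[ℂ] V₂ := fun j =>
    (TensorProduct.lid ℂ V₂).toLinearMap ∘ₗ TensorProduct.map (φ₁.toBasis.coord j) LinearMap.id
    with hπ
  have hfa (j v) : f j v = φ₁ j ⊗ₜ[ℂ] v := rfl
  have hπa (j) (v : V₁) (w : V₂) : π j (v ⊗ₜ[ℂ] w) = φ₁.toBasis.repr v j • w := by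
    simp [hπ]
  have hπf (j v) : π j (f j v) = v := by
    rw [hfa, hπa, ← φ₁.coe_toBasis, Module.Basis.repr_self, Finsupp.single_eq_same, one_smul]
  have hsum (w) : ∑ j, f j (π j w) = w := by
    induction w using TensorProduct.induction_on with
    | zero => simp
    | tmul v w =>
      simp only [hπa, hfa]
      conv_rhs => rw [← φ₁.toBasis.sum_repr v, TensorProduct.sum_tmul]
      exact Finset.sum_congr rfl fun j _ => by
        rw [← TensorProduct.smul_tmul, φ₁.coe_toBasis]
    | add x y hx hy =>
      simp only [map_add, Finset.sum_add_distrib, hx, hy]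
  have hSf (j v) : (TensorProduct.map ℓ₁ LinearMap.id) (f j v) =
      (spec q α₁ (idx N₁ j) : ℂ) • f j v := by
    rw [hfa, TensorProduct.map_tmul, hφ₁, ← TensorProduct.smul_tmul', LinearMap.id_apply]
  have hℓrepr (j) (v : V₁) : φ₁.toBasis.repr (ℓ₁ v) j =
      (spec q α₁ (idx N₁ j) : ℂ) * φ₁.toBasis.repr v j :=
    repr_apply_of_apply_eq_smul φ₁.toBasis (by simpa only [φ₁.coe_toBasis] using hφ₁) v j
  have hπS (j w) : π j ((TensorProduct.map ℓ₁ LinearMap.id) w) =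
      (spec q α₁ (idx N₁ j) : ℂ) • π j w := by
    induction w using TensorProduct.induction_on with
    | zero => simp
    | tmul v w =>
      rw [TensorProduct.map_tmul, hπa, hπa, hℓrepr, LinearMap.id_apply, mul_smul]
    | add x y hx hy => simp only [map_add, hx, hy, smul_add]
  have hcomm : (TensorProduct.map ℓ₁ LinearMap.id : Module.End ℂ (V₁ ⊗[ℂ] V₂)) * T =
      T * TensorProduct.map ℓ₁ LinearMap.id := by
    have h := rel_apply ρ (Rel.central_L (p := stdParams q α₀ α₁ α₂ N₁ N₂) .oneK1_L2 1)
    rw [map_mul, map_mul] at h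
    rw [← hρ.L1one]
    exact h
  have hμ : Function.Injective fun j : Fin (N₁ + 1) => ((spec q α₁ (idx N₁ j) : ℝ) : ℂ) :=
    fun i j h => Fin.ext (spec_idx_injective hq₀ hq₁ α₁ N₁ (Complex.ofReal_injective h))
  set K : Module.End ℂ V₂ := π j₁ ∘ₗ T ∘ₗ f j₁ with hK
  have hTf (v) : T (f j₁ v) = f j₁ (K v) :=
    apply_eq_of_commute f π hsum hμ hSf hπS hcomm j₁ v
  have hLf (v) : ρ (AW2.gen _ .oneK1) (f j₁ v) = f j₁ (κ₂ v) := by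
    rw [hρ.oneK1]
    rfl
  have hinj : Function.Injective (f j₁) := Function.LeftInverse.injective (hπf j₁)
  -- `A₁` is replaced by the eigenvalue of `L₁ ⊗ 1` on `φ₁ j₁`, which is `sinh_q(β₀)`.
  set β₀ : ℝ := α₁ + 2 * j₁ - N₁ with hβ₀
  have hspec0 : spec q α₁ (idx N₁ j₁) = sinhq q β₀ := by
    rw [spec, idx, hβ₀]
    congr 1
    ring
  have hspec (j₂ : ℕ) : spec q β₀ (idx N₂ j₂) = spec q α₁ (idx' N₂ j₂ N₁ j₁) := by
    rw [spec, spec, idx, idx', idx, hβ₀]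
    congr 1
    ring
  -- the structure parameters before the exchange of the two generators
  set r : Fin 6 → ℝ := ![sinhq q α₀, sinhq q β₀, coshq q α₂, coshq q (-(N₂ : ℝ) - 1),
    sinhq q 1 ^ 2, sinhq q 1 ^ 2] with hr
  let R := ρ.comp (RingQuot.mkAlgHom ℂ (Rel (stdParams q α₀ α₁ α₂ N₁ N₂)))
  have hPf : ∀ s v, R ((row (stdParams q α₀ α₁ α₂ N₁ N₂) .oneK1_L2).P s) (f j₁ v) =
      f j₁ (algebraMap ℂ (Module.End ℂ V₂) (r s : ℂ) v) := by
    have hc (x : ℝ) (v : V₂) : R (row.c x) (f j₁ v) =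
        f j₁ (algebraMap ℂ (Module.End ℂ V₂) (x : ℂ) v) := by
      rw [row.c, R.commutes, Module.algebraMap_end_apply, Module.algebraMap_end_apply,
        map_smul]
    intro s v
    fin_cases s
    · exact hc _ v
    · change ρ (AW2.gen _ .L1one) (f j₁ v) =
        f j₁ (algebraMap ℂ (Module.End ℂ V₂) (sinhq q β₀ : ℂ) v)
      rw [hρ.L1one, hSf, hspec0, Module.algebraMap_end_apply, map_smul]
    · exact hc _ v
    · exact hc _ v
    · exact hc _ v
    · exact hc _ v
  -- The relation does not see the sign of `α₂`, which only exchanges the denominator parameters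
  -- `αq` and `βδq` of the polynomial; `-α₂` gives them the order they have in `bivarQRacah`.
  have hcosh : coshq q (-α₂) = coshq q α₂ := by
    rw [coshq, coshq, neg_neg, add_comm]
  have hF : awFst q K κ₂ (fun s => algebraMap ℂ _ (awScalars q β₀ α₀ (-α₂) N₂ s : ℂ)) = 0 := by
    rw [awFst_swap q κ₂ K (p := fun s => (r s : ℂ)) rfl rfl (congrArg _ hcosh) rfl rfl]
    ext v
    apply hinj
    rw [← awSnd_apply_of_intertwine q (f j₁) hLf hTf hPf]
    exact (LinearMap.congr_fun (awSnd_row_eq_zero ρ .oneK1_L2) (f j₁ v)).trans (map_zero _).symm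
  have hS : awSnd q K κ₂ (fun s => algebraMap ℂ _ (awScalars q β₀ α₀ (-α₂) N₂ s : ℂ)) = 0 := by
    rw [awSnd_swap q κ₂ K (p := fun s => (r s : ℂ)) rfl rfl (congrArg _ hcosh) rfl rfl]
    ext v
    apply hinj
    rw [← awFst_apply_of_intertwine q (f j₁) hLf hTf hPf]
    exact (LinearMap.congr_fun (awFst_row_eq_zero ρ .oneK1_L2) (f j₁ v)).trans (map_zero _).symm
  have hnd' : ∀ j : ℕ, 1 ≤ j → j ≤ N₂ →
      β₀ - α₀ - -α₂ ≠ 2 * j - N₂ - 1 ∧ β₀ - α₀ + -α₂ ≠ 2 * j - N₂ - 1 := by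
    intro j hj1 hj2
    have hj₁ : j₁.val ≤ N₁ := Nat.lt_succ_iff.1 j₁.isLt
    have h := hnd ((N₁ - j₁) + (j - 1)) (by omega)
    push_cast [Nat.cast_sub hj1, Nat.cast_sub hj₁] at h
    exact ⟨fun h' => h.2 (by linear_combination -h'), fun h' => h.1 (by linear_combination -h')⟩
  have hψ : ∀ k, κ₂ (ψ₂.toBasis k) = (spec q α₀ (idx N₂ k) : ℂ) • ψ₂.toBasis k := by
    simpa only [ψ₂.coe_toBasis] using hψ₂
  obtain ⟨⟨b, hb⟩, g, hg, hgR⟩ := aw_pair_eigenvector hq₀ hq₁ ψ₂.toBasis hψ hF hS hnd'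
  refine ⟨⟨b, fun j₂ => ?_⟩, g, hg, fun j₂ v hv hTv => ?_⟩
  · rw [← hfa, hTf, hb, map_smul, hspec]
  · rw [← hfa, hTf, ← map_smul] at hTv
    obtain ⟨h0, h⟩ := hgR j₂ (Nat.lt_succ_iff.1 j₂.isLt) v hv (by rw [hspec]; exact hinj hTv)
    refine ⟨_, h0, fun k => ?_⟩
    rw [← h k, ψ₂.coe_toBasis_repr_apply, ψ₂.repr_apply_apply]

end Rep

/-! ### The bivariate polynomials -/

lemma sq_pow_eq_rpow (q : ℝ) (n : ℕ) : (q ^ 2) ^ n = q ^ (2 * (n : ℝ)) := by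
  rw [← pow_mul, ← Real.rpow_natCast]
  push_cast
  rfl

lemma sq_rpow_eq_rpow {q : ℝ} (hq : 0 < q) (x : ℝ) : (q ^ 2) ^ x = q ^ (2 * x) := by
  rw [Real.rpow_mul hq.le, Real.rpow_ofNat]

lemma sq_eq_rpow (q : ℝ) : q ^ 2 = q ^ (2 : ℝ) := (Real.rpow_ofNat q 2).symm

/-- By duality, exchanging `k₂` and `j₂` turns the second factor of the bivariate polynomial into
the univariate polynomial attached to the pair `L₂`, `1 ⊗ K₁`. -/
lemma bivarQRacah_eq_mul {q : ℝ} (hq : 0 < q) (α₀ α₁ α₂ : ℝ) (N₁ N₂ k₁ k₂ j₁ j₂ : ℕ) :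
    bivarQRacah q α₀ α₁ α₂ N₁ N₂ k₁ k₂ j₁ j₂ =
      awRacah q (α₀ + 2 * k₂ - N₂) α₁ α₂ N₁ k₁ j₁ *
        awRacah q (α₁ + 2 * j₁ - N₁) α₀ (-α₂) N₂ j₂ k₂ := by
  rw [bivarQRacah, awRacah, awRacah]
  congr 1
  rw [qRacah, qRacah, phi43_comm_of_terminating (by positivity)]
  simp only [sq_pow_eq_rpow]
  simp only [sq_eq_rpow q, neg_mul, mul_neg, ← Real.rpow_add hq]
  push_cast
  congr 3 <;> ring

/-! ### Comparison with the Gasper–Rahman polynomials -/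

lemma phi43_swap_num (n : ℕ) (a b c d e f q : ℝ) :
    phi43 n a b c d e f q = phi43 n a c b d e f q :=
  Finset.sum_congr rfl fun l _ => by ring

lemma phi43_swap_den (n : ℕ) (a b c d e f q : ℝ) :
    phi43 n a b c d e f q = phi43 n a b c e d f q :=
  Finset.sum_congr rfl fun l _ => by ring

lemma qPoch_rpow_ne_zero {q : ℝ} (hq : 0 < q) (hq1 : q < 1) {x : ℝ} {n : ℕ}
    (h : ∀ i < n, x + 2 * i ≠ 0) : qPoch (q ^ x) (q ^ 2) n ≠ 0 :=
  qPoch_ne_zero fun i hi h1 => by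
    rw [sq_pow_eq_rpow, ← Real.rpow_add hq] at h1
    refine h i hi ((Real.strictAnti_rpow_of_base_lt_one hq hq1).injective ?_)
    simpa using h1

/-- Sears' transformation in base `q²` for parameters `A = -q^a`, `D = -q^d`, `E = -q^e`, `F = q^f`,
together with the non-vanishing of the factor that it produces. -/
lemma sears_rpow {q : ℝ} (hq : 0 < q) (hq1 : q < 1) {n : ℕ} {a b c d e f : ℝ}
    (hbal : d + e + f + 2 * n = a + b + c + 2)
    (hf : ∀ i < n, f + 2 * i ≠ 0) (hda : ∀ i < n, d - a + 2 * i ≠ 0) :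
    searsFactor n (-q ^ a) (-q ^ d) (q ^ f) (q ^ 2) ≠ 0 ∧
    phi43 n (-q ^ a) (q ^ b) (-q ^ c) (-q ^ d) (-q ^ e) (q ^ f) (q ^ 2) =
      searsFactor n (-q ^ a) (-q ^ d) (q ^ f) (q ^ 2) *
        phi43 n (-q ^ a) (q ^ (e - c)) (-q ^ (e - b)) (-q ^ e) (-q ^ (a + 2 - 2 * n - f))
          (q ^ (a + 2 - 2 * n - d)) (q ^ 2) := by
  have hp : 0 < q ^ 2 := by positivity
  have hp1 : q ^ 2 < 1 := pow_lt_one₀ hq.le hq1 two_ne_zero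
  have P (x : ℝ) : 0 < q ^ x := Real.rpow_pos_of_pos hq x
  have e1 : -q ^ d / -q ^ a = q ^ (d - a) := by rw [neg_div_neg_eq, Real.rpow_sub hq]
  have e2 : q ^ f / -q ^ a = -q ^ (f - a) := by rw [div_neg, Real.rpow_sub hq]
  have hdn := qPoch_neg_ne_zero (P d) hp n
  have hen := qPoch_neg_ne_zero (P e) hp n
  have hfn := qPoch_rpow_ne_zero hq hq1 hf
  have hdan : qPoch (-q ^ d / -q ^ a) (q ^ 2) n ≠ 0 := by
    rw [e1]
    exact qPoch_rpow_ne_zero hq hq1 hda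
  have hfan : qPoch (q ^ f / -q ^ a) (q ^ 2) n ≠ 0 := by
    rw [e2]
    exact qPoch_neg_ne_zero (P _) hp n
  have ha : -q ^ a ≠ 0 := neg_ne_zero.2 (P a).ne'
  refine ⟨div_ne_zero (mul_ne_zero (pow_ne_zero n ha) (mul_ne_zero hdan hfan))
    (mul_ne_zero hdn hfn), ?_⟩
  rw [sears_transformation hp hp1 ha (P b).ne' (neg_ne_zero.2 (P c).ne')
    (neg_ne_zero.2 (P d).ne') (neg_ne_zero.2 (P e).ne') (P f).ne' ?_ hdn hen hfn hdan hfan,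
    phi43_swap_num]
  · congr 2
    · rw [neg_div_neg_eq, Real.rpow_sub hq]
    · rw [neg_div, Real.rpow_sub hq]
    · rw [sq_pow_eq_rpow, sq_eq_rpow q, neg_mul, neg_div, ← Real.rpow_add hq, ← Real.rpow_add hq,
        ← Real.rpow_sub hq]
      congr 2
      ring
    · rw [sq_pow_eq_rpow, sq_eq_rpow q, neg_mul, mul_neg, neg_div_neg_eq, ← Real.rpow_add hq,
        ← Real.rpow_add hq, ← Real.rpow_sub hq]
      congr 1
      ring
  · rw [sq_pow_eq_rpow, sq_eq_rpow q]
    simp only [neg_mul, mul_neg, neg_neg, ← Real.rpow_add hq]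
    congr 1

/-- Two applications of Sears' transformation relate the two bivariate `q`-Racah polynomials. -/
theorem specializedGR_eq {q α₀ α₁ α₂ : ℝ} (hq : 0 < q) (hq1 : q < 1) {N₁ N₂ : ℕ}
    (hnd : ∀ i : ℕ, i < N₁ + N₂ → α₀ - α₁ + α₂ ≠ N₁ + N₂ - 1 - 2 * i) {k₁ k₂ j₁ : ℕ} (j₂ : ℕ)
    (hk₁ : k₁ ≤ N₁) (hk₂ : k₂ ≤ N₂) (hj₁ : j₁ ≤ N₁) :
    grFactor q α₀ α₁ α₂ N₁ N₂ k₁ k₂ j₁ ≠ 0 ∧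
      specializedGR q α₀ α₁ α₂ N₁ N₂ k₁ k₂ j₁ j₂ =
        grFactor q α₀ α₁ α₂ N₁ N₂ k₁ k₂ j₁ * bivarQRacah q α₀ α₁ α₂ N₁ N₂ k₁ k₂ j₁ j₂ := by
  obtain ⟨s1, t1⟩ := sears_rpow hq hq1 (n := k₂) (a := 2 * k₂ + 2 * α₀ - 2 * N₂)
    (b := -(2 * j₁ + 2 * j₂ - (α₀ - α₁ + α₂) - N₁ - N₂ - 1))
    (c := 2 * α₀ + 2 * α₂ + 2 + (2 * j₁ + 2 * j₂ - (α₀ - α₁ + α₂) - N₁ - N₂ - 1))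
    (d := 2 * α₀ + 2) (e := 2 * α₀ + 2 * α₂ + 2 - 2 * N₂ + (2 * j₁ - (α₀ - α₁ + α₂) - N₁ + N₂ - 1))
    (f := -2 * j₁ + (α₀ - α₁ + α₂) + N₁ - N₂ + 1) (by ring)
    -- nonvanishing of `(f; q²)_n`, which is part of the nondegeneracy condition
    (fun i hi h => by
      have h' := hnd (N₁ - j₁ + i) (by omega)
      push_cast [Nat.cast_sub hj₁] at h'
      exact h' (by linear_combination h))
    (fun i hi h => by
      have hk : (k₂ : ℝ) ≤ N₂ := by exact_mod_cast hk₂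
      have hi0 : (0 : ℝ) ≤ i := Nat.cast_nonneg i
      linarith)
  obtain ⟨s2, t2⟩ := sears_rpow hq hq1 (n := k₁)
    (a := 4 * k₂ + 2 * k₁ + 2 * α₀ - 2 * N₁ - 2 * N₂)
    (b := 2 * k₂ - (2 * j₁ - (α₀ - α₁ + α₂) - N₁ + N₂ - 1))
    (c := 2 * α₀ + 2 * α₂ + 2 - 2 * N₂ + 2 * k₂ + (2 * j₁ - (α₀ - α₁ + α₂) - N₁ + N₂ - 1))
    (d := 4 * k₂ + 2 * α₀ - 2 * N₂ + 2)
    (e := 2 * α₀ + 2 * α₂ + 2 - 2 * N₂ - 2 * N₁ + 2 * k₂ + (-(α₀ - α₁ + α₂) + N₁ + N₂ - 1))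
    (f := 2 * k₂ + (α₀ - α₁ + α₂) - N₁ - N₂ + 1) (by ring)
    (fun i hi h => by
      have h' := hnd (k₂ + i) (by omega)
      push_cast at h'
      exact h' (by linear_combination h))
    (fun i hi h => by
      have hk : (k₁ : ℝ) ≤ N₁ := by exact_mod_cast hk₁
      have hi0 : (0 : ℝ) ≤ i := Nat.cast_nonneg i
      linarith)
  refine ⟨mul_ne_zero s1 s2, ?_⟩
  refine (Eq.trans ?_ (congrArg₂ (· * ·) t1 t2)).trans ?_
  · rw [specializedGR, gasperRahman]
    simp only [sq_pow_eq_rpow, sq_rpow_eq_rpow hq]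
    simp only [sq_eq_rpow q, neg_mul, mul_neg, ← Real.rpow_add hq]
    push_cast
    congr 1 <;> congr 2 <;> ring_nf
  · rw [grFactor, mul_mul_mul_comm]
    congr 1
    rw [bivarQRacah, mul_comm, qRacah, qRacah, phi43_swap_den k₂]
    simp only [sq_pow_eq_rpow, sq_rpow_eq_rpow hq]
    simp only [sq_eq_rpow q, neg_mul, mul_neg, ← Real.rpow_add hq]
    push_cast
    congr 3 <;> ring_nf

end RankTwoAW

open RankTwoAW in
theorem mainTheorem1
    (q α₀ α₁ α₂ : ℝ) (hq₀ : 0 < q) (hq₁ : q < 1) (N₁ N₂ : ℕ)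
    -- nondegeneracy: `α₀ - α₁ ± α₂` avoids the values `N₁ + N₂ - 1 - 2i`, `0 ≤ i ≤ N₁ + N₂ - 1`
    (hnd : ∀ i : ℕ, i < N₁ + N₂ →
      α₀ - α₁ + α₂ ≠ N₁ + N₂ - 1 - 2 * i ∧ α₀ - α₁ - α₂ ≠ N₁ + N₂ - 1 - 2 * i)
    {V₁ V₂ : Type*} [NormedAddCommGroup V₁] [InnerProductSpace ℂ V₁]
    [NormedAddCommGroup V₂] [InnerProductSpace ℂ V₂]
    (ρ : AW2 (stdParams q α₀ α₁ α₂ N₁ N₂) →ₐ[ℂ] Module.End ℂ (V₁ ⊗[ℂ] V₂))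
    (κ₁ ℓ₁ : V₁ →ₗ[ℂ] V₁) (κ₂ ℓ₂ : V₂ →ₗ[ℂ] V₂) (hρ : ExtendsTensor ρ κ₁ ℓ₁ κ₂ ℓ₂)
    (φ₁ : OrthonormalBasis (Fin (N₁ + 1)) ℂ V₁)
    (hφ₁ : ∀ j, ℓ₁ (φ₁ j) = (spec q α₁ (idx N₁ j) : ℂ) • φ₁ j)
    (ψ₂ : OrthonormalBasis (Fin (N₂ + 1)) ℂ V₂)
    (hψ₂ : ∀ k, κ₂ (ψ₂ k) = (spec q α₀ (idx N₂ k) : ℂ) • ψ₂ k) :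
    (∃ b : Fin (N₂ + 1) → Module.Basis (Fin (N₁ + 1)) ℂ V₁,
      IsKEigenfamily q α₀ N₁ N₂ (ρ (AW2.gen _ .K2)) ψ₂ (fun k₂ k₁ => b k₂ k₁)) ∧
    (∃ b : Fin (N₁ + 1) → Module.Basis (Fin (N₂ + 1)) ℂ V₂,
      IsLEigenfamily q α₁ N₁ N₂ (ρ (AW2.gen _ .L2)) φ₁ (fun j₁ j₂ => b j₁ j₂)) ∧
    (∀ (ψ₁ : Fin (N₂ + 1) → Fin (N₁ + 1) → V₁) (φ₂ : Fin (N₁ + 1) → Fin (N₂ + 1) → V₂),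
      IsKEigenfamily q α₀ N₁ N₂ (ρ (AW2.gen _ .K2)) ψ₂ ψ₁ →
      IsLEigenfamily q α₁ N₁ N₂ (ρ (AW2.gen _ .L2)) φ₁ φ₂ →
      ∀ (k₁ : Fin (N₁ + 1)) (k₂ : Fin (N₂ + 1)) (j₁ : Fin (N₁ + 1)) (j₂ : Fin (N₂ + 1)),
        normNum φ₁ φ₂ ψ₁ ψ₂ k₂ j₁ ≠ 0 ∧
        normDen φ₁ φ₂ ψ₁ ψ₂ k₁ k₂ j₁ j₂ ≠ 0 ∧
        overlap φ₁ φ₂ ψ₁ ψ₂ k₁ k₂ j₁ j₂ = (bivarQRacah q α₀ α₁ α₂ N₁ N₂ k₁ k₂ j₁ j₂ : ℂ)) ∧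
    (∀ k₁ k₂ j₁ j₂ : ℕ, k₁ ≤ N₁ → k₂ ≤ N₂ → j₁ ≤ N₁ → j₂ ≤ N₂ →
      grFactor q α₀ α₁ α₂ N₁ N₂ k₁ k₂ j₁ ≠ 0 ∧
      specializedGR q α₀ α₁ α₂ N₁ N₂ k₁ k₂ j₁ j₂ =
        grFactor q α₀ α₁ α₂ N₁ N₂ k₁ k₂ j₁ * bivarQRacah q α₀ α₁ α₂ N₁ N₂ k₁ k₂ j₁ j₂) := by
  have hnd' : ∀ i : ℕ, i < N₁ + N₂ → α₀ - α₁ + α₂ ≠ N₁ + N₂ - 1 - 2 * i := fun i hi => (hnd i hi).1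
  choose hK₁ hK₂ using fun k₂ => K2_eigenvectors hq₀ hq₁ hnd ρ hρ φ₁ hφ₁ ψ₂ hψ₂ k₂
  choose bK hbK using hK₁
  choose gK hgK hK using hK₂
  choose hL₁ hL₂ using fun j₁ => L2_eigenvectors hq₀ hq₁ hnd ρ hρ φ₁ hφ₁ ψ₂ hψ₂ j₁
  choose bL hbL using hL₁
  choose gL hgL hL using hL₂
  refine ⟨⟨bK, fun k₂ k₁ => ⟨(bK k₂).ne_zero k₁, hbK k₂ k₁⟩⟩,
    ⟨bL, fun j₁ j₂ => ⟨(bL j₁).ne_zero j₂, hbL j₁ j₂⟩⟩, ?_,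
    fun k₁ k₂ j₁ j₂ hk₁ hk₂ hj₁ _ => specializedGR_eq hq₀ hq₁ hnd' j₂ hk₁ hk₂ hj₁⟩
  intro ψ₁ φ₂ hψ₁ hφ₂ k₁ k₂ j₁ j₂
  -- The inner products are `a · g · R`, with `a` depending on the eigenvector and `g` on the basis
  -- vector only; all these factors cancel in the normalization.
  choose a ha hψ using fun k₁ => hK k₂ k₁ (ψ₁ k₂ k₁) (hψ₁ k₂ k₁).1 (hψ₁ k₂ k₁).2
  choose c hc hφ using fun j₂ => hL j₁ j₂ (φ₂ j₁ j₂) (hφ₂ j₁ j₂).1 (hφ₂ j₁ j₂).2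
  have hφ' (j₂ k₂) : inner ℂ (φ₂ j₁ j₂) (ψ₂ k₂) = star (c j₂) * star (gL j₁ k₂) *
      awRacah q (α₁ + 2 * j₁ - N₁) α₀ (-α₂) N₂ j₂ k₂ := by
    rw [← inner_conj_symm, hφ]
    simp
  have hnum : normNum φ₁ φ₂ ψ₁ ψ₂ k₂ j₁ = a 0 * gK k₂ 0 * (star (c 0) * star (gL j₁ 0)) := by
    rw [normNum, hψ, hφ']
    simp [awRacah_zero_right]
  have hden : normDen φ₁ φ₂ ψ₁ ψ₂ k₁ k₂ j₁ j₂ = a 0 * gK k₂ j₁ * (star (c j₂) * star (gL j₁ 0)) *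
      (a k₁ * gK k₂ 0) * (star (c 0) * star (gL j₁ k₂)) := by
    rw [normDen, hψ, hφ', hψ, hφ']
    simp [awRacah_zero_right, awRacah_zero_left]
  have hnum0 : normNum φ₁ φ₂ ψ₁ ψ₂ k₂ j₁ ≠ 0 := by simp [hnum, ha, hgK, hc, hgL]
  have hden0 : normDen φ₁ φ₂ ψ₁ ψ₂ k₁ k₂ j₁ j₂ ≠ 0 := by simp [hden, ha, hgK, hc, hgL]
  refine ⟨hnum0, hden0, ?_⟩
  rw [overlap, div_mul_eq_mul_div, div_eq_iff hden0, TensorProduct.inner_tmul, hψ, hφ', hnum, hden,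
    bivarQRacah_eq_mul hq₀]
  push_cast
  ring
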